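/- Let $\Omega=(l_1,l_2)\times(l_3,l_4)$ be a rectangle, $\Gamma_1=\{l_1\}\times(l_3,l_4)$ its left side, and $P=(l_1,y_0)\in\Gamma_1$ a side point. Let $a>0$ be a coefficient on $\overline\Omega$ with partial derivatives up to order $6$, and $\alpha$ a function on the side with derivatives up to order $5$, all continuous up to the boundary. (For an elliptic interface problem, $\overline\Omega$ is any closed rectangle that is adjacent to the side point and does not meet the interface.) Consider $$-\nabla\cdot(a\nabla u)=f\ \text{ in }\Omega,\qquad \mathcal B_1u:=\frac{\partial u}{\partial\vec n}+\alpha u=-u_x+\alpha u=g_1\ \text{ on }\Gamma_1,$$ where $u$ is $C^7$ and $f$, $g_1$ are $C^5$ up to the boundary. Write $w^{(m,n)}=\partial_x^m\partial_y^nw(P)$ for functions of two variables and $b^{(n)}=b^{(n)}(y_0)$ for functions on $\Gamma_1$. Let $\Lambda_K=\{(m,n)\in\mathbb Z_{\ge0}^2: m+n\le K\}$ and $\Lambda^{V,2}_K=\{(m,n)\in\Lambda_K:m\ge2\}$. Differentiating the equation at $P$ expresses each $u^{(m',n')}$ with $m'\ge 2$ uniquely as a linear combination of $u^{(0,n)}$,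 $u^{(1,n)}$ and $f^{(m,n)}$; let $A^{u}_{m',n',m,n}$ ($m\in\{0,1\}$) and $A^{f}_{m',n',m,n}$ be the coefficients of $u^{(m,n)}$ and of $f^{(m,n)}$ (they depend only on the derivatives of $a$ at $P$). For $m\in\{0,1\}$ put $$G_{m,n}(x,y)=\sum_{\ell=0}^{\lfloor n/2\rfloor}\frac{(-1)^\ell x^{m+2\ell}y^{n-2\ell}}{(m+2\ell)!\,(n-2\ell)!}+\sum_{(m',n')\in\Lambda^{V,2}_{6}\setminus\Lambda^{V,2}_{m+n}}A^{u}_{m',n',m,n}\frac{x^{m'}y^{n'}}{m'!\,n'!},$$ and for $(m,n)\in\Lambda_4$ $$Q_{m,n}(x,y)=\sum_{\ell=1}^{1+\lfloor n/2\rfloor}\frac{(-1)^\ell x^{m+2\ell}y^{n-2\ell+2}}{(m+2\ell)!\,(n-2\ell+2)!}\,\frac1{a(P)}+\sum_{(m',n')\in\Lambda^{V,2}_{6}\setminus\Lambda^{V,2}_{m+n+2}}A^{f}_{m',n',m,n}\frac{x^{m'}y^{n'}}{m'!\,n'!}.$$ For real numbers $c_{k,\ell,i}$ ($k\in\{0,1\}$,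 $\ell\in\{-1,0,1\}$, $0\le i\le6$) let $C_{k,\ell}(h)=\sum_{i=0}^6c_{k,\ell,i}h^i$, and consider the linear system for the $c_{k,\ell,i}$ induced by $$\sum_{k,\ell}C_{k,\ell}(h)\Big(G_{0,n}(kh,\ell h)+\sum_{i=n}^{5}\binom in\alpha^{(i-n)}G_{1,i}(kh,\ell h)\Big)=\mathcal O(h^7)\quad(h\to0^+),\qquad n=0,1,\dots,6 \qquad(*)$$ (the inner sum is empty for $n=6$). Consider further the 6-point scheme $$\mathcal L_hu:=\sum_{k,\ell}C_{k,\ell}(h)\,u(l_1+kh,y_0+\ell h)=\sum_{(m,n)\in\Lambda_4}f^{(m,n)}C_{f,m,n}+\sum_{n=0}^5g_1^{(n)}C_{g_1,n},\qquad(**)$$ $$C_{f,m,n}=\sum_{k,\ell}C_{k,\ell}\,Q_{m,n}(kh,\ell h),\qquad C_{g_1,n}=-\sum_{k,\ell}C_{k,\ell}\,G_{1,n}(kh,\ell h).$$ 1. For every solution of $(*)$ the scheme $(**)$, scaled by $h^{-1}$, has truncation error of sixth order for $\mathcal B_1u=g_1$ at $P$: for all exact $u,f,g_1$ as above, $h^{-1}\big(\mathcal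 L_hu-\text{right-hand side}\big)=\mathcal O(h^6)$ as $h\to0^+$. If the solution is nontrivial in the sense that $c_{k,\ell,0}\ne0$ for some $(k,\ell)$, then moreover $h^{-1}\mathcal L_hw\to\kappa\,\mathcal B_1w(P)$ for every $w\in C^1(\overline\Omega)$, with a constant $\kappa\neq0$ independent of $w$. The system $(*)$ always has such a nontrivial solution. 2. Six is the maximum order of a 6-point scheme at $P$. Call a 6-point scheme any relation $\sum_{k,\ell}C_{k,\ell}(h)u(l_1+kh,y_0+\ell h)=\sum_{m+n\le K}f^{(m,n)}C_{f,m,n}(h)+\sum_{n\le K'}g_1^{(n)}C_{g_1,n}(h)$ on the same six points, with arbitrary finite $K,K'$, arbitrary functions of $h$ as coefficients, and the $C_{k,\ell}(h)$ not all tending to $0$ as $h\to0^+$; it has order $p\in\mathbb Z_{\ge 0}$ if $h^{-1}$ times the difference of its two sides is $\mathcal O(h^p)$ as $h\to0^+$ for all exact $u,f,g_1$ that are $C^\infty$ up to the boundary. Then $6$ is the greatest $p$ such that for all $C^\infty$ functions $\alpha$ and $a>0$ (up to the boundary) there is a 6-point scheme of order $p$ at $P$. Moreover, for each individual such pair $(a,\alpha)$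 with $2a(P)\alpha(y_0)+a_x(P)\ne0$, $6$ is the greatest order of a 6-point scheme at $P$. -/

import Mathlib

open Set Filter Topology Asymptotics
open scoped ContDiff

/-- A rectangle `Ω = (l₁, l₂) × (l₃, l₄)` with a side point `(l₁, y₀)` of its left side
`Γ₁ = {l₁} × (l₃, l₄)`. -/
structure SideRect where
  l₁ : ℝ
  l₂ : ℝ
  l₃ : ℝ
  l₄ : ℝ
  y₀ : ℝ
  hx : l₁ < l₂
  hy₃ : l₃ < y₀
  hy₄ : y₀ < l₄

/-- The index set `Λ_K = {(m, n) : m + n ≤ K}`. -/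
def Lam (K : ℕ) : Finset (ℕ × ℕ) :=
  (Finset.range (K + 1) ×ˢ Finset.range (K + 1)).filter (fun p => p.1 + p.2 ≤ K)

/-- The index set `Λ_K^{V,2} = Λ_K \ Λ_K^{V,1}`, where `Λ_K^{V,1}` consists of the
`(m, n) ∈ Λ_K` with `m ∈ {0, 1}`. -/
def LamV2 (K : ℕ) : Finset (ℕ × ℕ) := (Lam K).filter (fun p => 2 ≤ p.1)

/-- The six stencil offsets `(k, ℓ)`, `k ∈ {0, 1}`, `ℓ ∈ {-1, 0, 1}`. -/
def stencil : Finset (ℤ × ℤ) := ({0, 1} : Finset ℤ) ×ˢ ({-1, 0, 1} : Finset ℤ)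

/-- Formal differentiation of `-∇·(a∇u) = f`, that is, of
`u_xx = - u_yy - (log a)_x u_x - (log a)_y u_y - f / a`.
Given the derivatives `L i j` of `log a`, `R i j` of `1 / a` and `F i j` of `f` at the base point,
together with the values `φ 0 n` of `∂_y^n u` and `φ 1 n` of `∂_x ∂_y^n u` there, `formalJet` computes
`∂_x^m ∂_y^n u` at the base point by applying `∂_x^m ∂_y^n` to this equation (Leibniz rule). -/
noncomputable def formalJet (L R φ F : ℕ → ℕ → ℝ) : ℕ → ℕ → ℝ
  | 0, n => φ 0 n
  | 1, n => φ 1 n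
  | m + 2, n =>
      - formalJet L R φ F m (n + 2)
      - ∑ i ∈ Finset.range (m + 1), ∑ j ∈ Finset.range (n + 1),
          ((m.choose i : ℝ) * (n.choose j : ℝ)) *
            (L (i + 1) j * formalJet L R φ F (m - i + 1) (n - j)
              + L i (j + 1) * formalJet L R φ F (m - i) (n - j + 1)
              + R i j * F (m - i) (n - j))
termination_by m _ => m

/-- The Kronecker symbol `δ_{(i,j),(m,n)}`. -/
def kron (m n i j : ℕ) : ℝ := if i = m ∧ j = n then 1 else 0

namespace SideRect

variable (D : SideRect)

/-- The open rectangle `Ω`. -/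
def Omega : Set (ℝ × ℝ) := Ioo D.l₁ D.l₂ ×ˢ Ioo D.l₃ D.l₄

/-- The closed rectangle. -/
def OmegaBar : Set (ℝ × ℝ) := Icc D.l₁ D.l₂ ×ˢ Icc D.l₃ D.l₄

/-- `w` has partial derivatives up to order `r` that extend continuously to the closed rectangle
(equivalently, are uniformly continuous in the rectangle). -/
def SmoothOn (r : ℕ∞) (w : ℝ → ℝ → ℝ) : Prop :=
  ContDiffOn ℝ (r : WithTop ℕ∞) (fun z : ℝ × ℝ => w z.1 z.2) D.OmegaBar

/-- `b` has derivatives up to order `r` that extend continuously to the closed side. -/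
def SmoothSide (r : ℕ∞) (b : ℝ → ℝ) : Prop :=
  ContDiffOn ℝ (r : WithTop ℕ∞) b (Icc D.l₃ D.l₄)

/-- `w^{(m,n)}`, the partial derivative `∂_x^m ∂_y^n w` at the base point `(l₁, y₀)`
(one-sided in `x`, the base point being on the left side). -/
noncomputable def pd (w : ℝ → ℝ → ℝ) (m n : ℕ) : ℝ :=
  iteratedDerivWithin m
    (fun x => iteratedDerivWithin n (fun y => w x y) (Icc D.l₃ D.l₄) D.y₀) (Icc D.l₁ D.l₂) D.l₁

/-- `b^{(n)}`, the `n`-th derivative at `y₀` of a function on the left side. -/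
noncomputable def bd (b : ℝ → ℝ) (n : ℕ) : ℝ := iteratedDeriv n b D.y₀

/-- The Robin operator `∂w/∂n + α w` at the point `(l₁, y)` of the left side, where the outward unit
normal is `(-1, 0)`. -/
noncomputable def robin (α : ℝ → ℝ) (w : ℝ → ℝ → ℝ) (y : ℝ) : ℝ :=
  - derivWithin (fun x => w x y) (Icc D.l₁ D.l₂) D.l₁ + α y * w D.l₁ y

/-- `u` is an exact solution, with data `f` and `g₁`, of `-∇·(a∇u) = f` in `Ω` with
`∂u/∂n + α u = g₁` on `Γ₁`; `u` is of class `C^{r+2}` and the data are of class `C^r`, up to the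
boundary. -/
structure IsExactSolution (a : ℝ → ℝ → ℝ) (α : ℝ → ℝ) (r : ℕ∞)
    (u f : ℝ → ℝ → ℝ) (g₁ : ℝ → ℝ) : Prop where
  smooth_u : D.SmoothOn (r + 2) u
  smooth_f : D.SmoothOn r f
  smooth_g : D.SmoothSide r g₁
  pde : ∀ x ∈ Ioo D.l₁ D.l₂, ∀ y ∈ Ioo D.l₃ D.l₄,
    - (deriv (fun s => a s y * deriv (fun t => u t y) s) x
        + deriv (fun s => a x s * deriv (fun t => u x t) s) y) = f x y
  bc : ∀ y ∈ Ioo D.l₃ D.l₄, D.robin α u y = g₁ y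

/-- `A^{V,u}_{m',n',m,n}`: the coefficient of `u^{(m,n)}` (`m ∈ {0, 1}`) when `u^{(m',n')}` is expressed,
by means of the differential equation, through the `u^{(0,·)}`, `u^{(1,·)}` and the derivatives
of `f`. -/
noncomputable def AVu (a : ℝ → ℝ → ℝ) (m' n' m n : ℕ) : ℝ :=
  formalJet (D.pd fun x y => Real.log (a x y)) (D.pd fun x y => (a x y)⁻¹)
    (kron m n) (fun _ _ => 0) m' n'

/-- `A^{V,f}_{m',n',m,n}`: the coefficient of `f^{(m,n)}` in the same expression of `u^{(m',n')}`. -/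
noncomputable def AVf (a : ℝ → ℝ → ℝ) (m' n' m n : ℕ) : ℝ :=
  formalJet (D.pd fun x y => Real.log (a x y)) (D.pd fun x y => (a x y)⁻¹)
    (fun _ _ => 0) (kron m n) m' n'

/-- The polynomial `G^V_{M,m,n}(x, y)`. -/
noncomputable def GV (a : ℝ → ℝ → ℝ) (M m n : ℕ) (x y : ℝ) : ℝ :=
  ∑ l ∈ Finset.range (n / 2 + 1),
      (-1 : ℝ) ^ l * x ^ (m + 2 * l) * y ^ (n - 2 * l)
        / (((m + 2 * l).factorial : ℝ) * ((n - 2 * l).factorial : ℝ))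
    + ∑ p ∈ LamV2 (M + 1) \ LamV2 (m + n),
      D.AVu a p.1 p.2 m n * (x ^ p.1 * y ^ p.2 / ((p.1.factorial : ℝ) * (p.2.factorial : ℝ)))

/-- The polynomial `Q^V_{M,m,n}(x, y)`. -/
noncomputable def QV (a : ℝ → ℝ → ℝ) (M m n : ℕ) (x y : ℝ) : ℝ :=
  ∑ l ∈ Finset.Icc 1 (1 + n / 2),
      (-1 : ℝ) ^ l * x ^ (m + 2 * l) * y ^ (n + 2 - 2 * l)
        / (((m + 2 * l).factorial : ℝ) * ((n + 2 - 2 * l).factorial : ℝ)) * (1 / a D.l₁ D.y₀)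
    + ∑ p ∈ LamV2 (M + 1) \ LamV2 (m + n + 2),
      D.AVf a p.1 p.2 m n * (x ^ p.1 * y ^ p.2 / ((p.1.factorial : ℝ) * (p.2.factorial : ℝ)))

end SideRect

/-- A 6-point finite difference scheme at a side point of the left side, for the data `f`, `g₁`:
`∑_{(k,ℓ)} C_{k,ℓ}(h) u(l₁ + k h, y₀ + ℓ h)
   = ∑_{m+n ≤ Kf} f^{(m,n)} C_{f,m,n}(h) + ∑_{n ≤ Kg} g₁^{(n)} C_{g₁,n}(h)`,
with coefficients that are arbitrary functions of the grid size `h`. -/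
structure SixPointScheme where
  C : ℤ × ℤ → ℝ → ℝ
  Kf : ℕ
  Kg : ℕ
  Cf : ℕ → ℕ → ℝ → ℝ
  Cg : ℕ → ℝ → ℝ

namespace SixPointScheme

variable (S : SixPointScheme)

/-- The left-hand side `L_h w`. -/
noncomputable def lhs (D : SideRect) (w : ℝ → ℝ → ℝ) (h : ℝ) : ℝ :=
  ∑ s ∈ stencil, S.C s h * w (D.l₁ + s.1 * h) (D.y₀ + s.2 * h)

/-- The right-hand side. -/
noncomputable def rhs (D : SideRect) (f : ℝ → ℝ → ℝ) (g₁ : ℝ → ℝ) (h : ℝ) : ℝ :=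
  ∑ p ∈ Lam S.Kf, D.pd f p.1 p.2 * S.Cf p.1 p.2 h
    + ∑ n ∈ Finset.range (S.Kg + 1), D.bd g₁ n * S.Cg n h

/-- The left-hand coefficients do not all tend to zero with the grid size. -/
def Nontrivial : Prop := ∃ s ∈ stencil, ¬ Tendsto (S.C s) (𝓝[>] 0) (𝓝 0)

/-- The scheme, in the scaling `h⁻¹ L_h` appropriate for a first-order boundary operator, has a
truncation error `O(h^p)` at every exact solution of smoothness `r`. -/
def HasTruncationOrder (D : SideRect) (a : ℝ → ℝ → ℝ) (α : ℝ → ℝ) (r : ℕ∞) (p : ℕ) : Prop :=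
  ∀ (u f : ℝ → ℝ → ℝ) (g₁ : ℝ → ℝ), D.IsExactSolution a α r u f g₁ →
    (fun h : ℝ => h⁻¹ * (S.lhs D u h - S.rhs D f g₁ h)) =O[𝓝[>] 0] fun h : ℝ => h ^ p

/-- `h⁻¹ L_h` approximates a nonzero multiple of the boundary operator at the side point. -/
def IsConsistent (D : SideRect) (α : ℝ → ℝ) : Prop :=
  ∃ κ : ℝ, κ ≠ 0 ∧ ∀ w : ℝ → ℝ → ℝ, D.SmoothOn 1 w →
    Tendsto (fun h : ℝ => h⁻¹ * S.lhs D w h) (𝓝[>] 0) (𝓝 (κ * D.robin α w D.y₀))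

end SixPointScheme

namespace SideRect

variable (D : SideRect)

/-- The polynomials `C_{k,ℓ}(h) = ∑_{i=0}^6 c_{k,ℓ,i} h^i`. -/
noncomputable def polyC (c : ℤ × ℤ → ℕ → ℝ) (s : ℤ × ℤ) (h : ℝ) : ℝ :=
  ∑ i ∈ Finset.range 7, c s i * h ^ i

/-- The linear system for the coefficients `c_{k,ℓ,i}`: for `n = 0, …, 6`,
`∑_{k,ℓ} C_{k,ℓ}(h) (G_{5,0,n}(kh,ℓh) + ∑_{i=n}^5 (i choose n) α^{(i-n)} G_{5,1,i}(kh,ℓh)) = O(h^7)`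
as `h → 0`. (The inner sum is empty for `n = 6`.) -/
def SolvesSystem (a : ℝ → ℝ → ℝ) (α : ℝ → ℝ) (c : ℤ × ℤ → ℕ → ℝ) : Prop :=
  ∀ n ∈ Finset.range 7,
    (fun h : ℝ => ∑ s ∈ stencil, polyC c s h *
      (D.GV a 5 0 n (s.1 * h) (s.2 * h)
        + ∑ i ∈ Finset.Icc n 5,
            (i.choose n : ℝ) * D.bd α (i - n) * D.GV a 5 1 i (s.1 * h) (s.2 * h)))
      =O[𝓝[>] 0] fun h : ℝ => h ^ 7

/-- The 6-point scheme with the coefficients `C_{k,ℓ}(h) = ∑_i c_{k,ℓ,i} h^i` and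
`C_{f,m,n} = ∑_{k,ℓ} C_{k,ℓ} Q_{5,m,n}(kh,ℓh)` for `m + n ≤ 4`,
`C_{g₁,n} = -∑_{k,ℓ} C_{k,ℓ} G_{5,1,n}(kh,ℓh)` for `n ≤ 5`. -/
noncomputable def robinScheme (a : ℝ → ℝ → ℝ) (c : ℤ × ℤ → ℕ → ℝ) : SixPointScheme where
  C := polyC c
  Kf := 4
  Kg := 5
  Cf := fun m n h => ∑ s ∈ stencil, polyC c s h * D.QV a 5 m n (s.1 * h) (s.2 * h)
  Cg := fun n h => - ∑ s ∈ stencil, polyC c s h * D.GV a 5 1 n (s.1 * h) (s.2 * h)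

end SideRect

/-!
At the side point the jet of an exact solution is parametrised by the tangential derivatives
`u^{(0,n)}` and by the jets of `f` and `g₁`, so the truncation order of a scheme is a condition on
the weighted sums over the stencil of the Taylor polynomials of the basic jets: for each `n`, the
formal solution with `f = 0`, `g₁ = 0` and tangential derivatives `δ_{k,n}`.

The lowest part of the `n`-th such jet is a harmonic polynomial of degree `n` and gives a functional
`Pₙ` on the six weights. The functionals `P₀, …, P₄` are independent, `180 P₅ = 15 P₃ - P₁` and
`360 P₆ = P₂`, so the common kernel is spanned by one vector, with entries `2, -10, 2` on the side
and `1, 4, 1` next to it. The higher coefficients of the weights are then found order by order,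
the two relations imposing a single further compatibility condition, which holds.

A scheme of order seven would make `360 P₆ = P₂` persist in the next degree. There the difference of
the two sides is `-(5/7) (2 α + (log a)_x)` times the leading weights, which is the barrier.
-/

open Finset.HasAntidiagonal (antidiagonal)

namespace SideRect

variable (D : SideRect)

lemma l₃_lt_l₄ : D.l₃ < D.l₄ := D.hy₃.trans D.hy₄

lemma l₁_mem : D.l₁ ∈ Icc D.l₁ D.l₂ := left_mem_Icc.2 D.hx.le

lemma y₀_mem : D.y₀ ∈ Icc D.l₃ D.l₄ := ⟨D.hy₃.le, D.hy₄.le⟩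

lemma base_mem : (D.l₁, D.y₀) ∈ D.OmegaBar := ⟨D.l₁_mem, D.y₀_mem⟩

lemma uniqueDiffX : UniqueDiffOn ℝ (Icc D.l₁ D.l₂) := uniqueDiffOn_Icc D.hx

lemma uniqueDiffY : UniqueDiffOn ℝ (Icc D.l₃ D.l₄) := uniqueDiffOn_Icc D.l₃_lt_l₄

lemma uniqueDiffOmegaBar : UniqueDiffOn ℝ D.OmegaBar := D.uniqueDiffX.prod D.uniqueDiffY

lemma closure_Omega : closure D.Omega = D.OmegaBar := by
  rw [Omega, closure_prod_eq, closure_Ioo D.hx.ne, closure_Ioo D.l₃_lt_l₄.ne, OmegaBar]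

lemma interior_OmegaBar : interior D.OmegaBar = D.Omega := by
  rw [OmegaBar, interior_prod_eq, interior_Icc, interior_Icc, Omega]

/-- The partial derivative in `x`, one-sided at the boundary of the rectangle. -/
noncomputable def dx (w : ℝ → ℝ → ℝ) : ℝ → ℝ → ℝ :=
  fun x y => derivWithin (fun s => w s y) (Icc D.l₁ D.l₂) x

/-- The partial derivative in `y`, one-sided at the boundary of the rectangle. -/
noncomputable def dy (w : ℝ → ℝ → ℝ) : ℝ → ℝ → ℝ :=
  fun x y => derivWithin (fun t => w x t) (Icc D.l₃ D.l₄) y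

/-- Equality on the closed rectangle, the only values which one-sided partial derivatives see. -/
def EqBar (w v : ℝ → ℝ → ℝ) : Prop :=
  ∀ x ∈ Icc D.l₁ D.l₂, ∀ y ∈ Icc D.l₃ D.l₄, w x y = v x y

variable {D} {w v : ℝ → ℝ → ℝ}

lemma EqBar.dx (h : D.EqBar w v) : D.EqBar (D.dx w) (D.dx v) := fun x hx y hy =>
  derivWithin_congr (fun s hs => h s hs y hy) (h x hx y hy)

lemma EqBar.dy (h : D.EqBar w v) : D.EqBar (D.dy w) (D.dy v) := fun x hx y hy =>
  derivWithin_congr (fun t ht => h x hx t ht) (h x hx y hy)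

lemma EqBar.dx_iterate (h : D.EqBar w v) (m : ℕ) : D.EqBar (D.dx^[m] w) (D.dx^[m] v) := by
  induction m generalizing w v with
  | zero => exact h
  | succ _ ih => exact ih h.dx

lemma EqBar.dy_iterate (h : D.EqBar w v) (n : ℕ) : D.EqBar (D.dy^[n] w) (D.dy^[n] v) := by
  induction n generalizing w v with
  | zero => exact h
  | succ _ ih => exact ih h.dy

lemma EqBar.trans {z : ℝ → ℝ → ℝ} (h : D.EqBar w v) (h' : D.EqBar v z) : D.EqBar w z :=
  fun x hx y hy => (h x hx y hy).trans (h' x hx y hy)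

lemma SmoothOn.of_le {r s : ℕ∞} (h : D.SmoothOn r w) (hs : s ≤ r) : D.SmoothOn s w :=
  ContDiffOn.of_le h (by exact_mod_cast hs)

lemma SmoothOn.add {r : ℕ∞} (h : D.SmoothOn r w) (h' : D.SmoothOn r v) :
    D.SmoothOn r (fun x y => w x y + v x y) := ContDiffOn.add h h'

lemma SmoothOn.mul {r : ℕ∞} (h : D.SmoothOn r w) (h' : D.SmoothOn r v) :
    D.SmoothOn r (fun x y => w x y * v x y) := ContDiffOn.mul h h'

lemma SmoothOn.neg {r : ℕ∞} (h : D.SmoothOn r w) :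
    D.SmoothOn r (fun x y => - w x y) := ContDiffOn.neg h

lemma SmoothOn.slice_x {r : ℕ∞} (h : D.SmoothOn r w) {y : ℝ} (hy : y ∈ Icc D.l₃ D.l₄) :
    ContDiffOn ℝ r (fun x => w x y) (Icc D.l₁ D.l₂) :=
  ContDiffOn.comp h (t := D.OmegaBar) (g := fun z : ℝ × ℝ => w z.1 z.2) (f := fun x => (x, y))
    (by fun_prop) fun _ hx => ⟨hx, hy⟩

lemma SmoothOn.slice_y {r : ℕ∞} (h : D.SmoothOn r w) {x : ℝ} (hx : x ∈ Icc D.l₁ D.l₂) :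
    ContDiffOn ℝ r (fun y => w x y) (Icc D.l₃ D.l₄) :=
  ContDiffOn.comp h (t := D.OmegaBar) (g := fun z : ℝ × ℝ => w z.1 z.2) (f := fun y => (x, y))
    (by fun_prop) fun _ hy => ⟨hx, hy⟩

lemma SmoothOn.hasFDerivWithinAt (h : D.SmoothOn 1 w) {z : ℝ × ℝ} (hz : z ∈ D.OmegaBar) :
    HasFDerivWithinAt (fun z : ℝ × ℝ => w z.1 z.2)
      (fderivWithin ℝ (fun z : ℝ × ℝ => w z.1 z.2) D.OmegaBar z) D.OmegaBar z :=
  ((ContDiffOn.differentiableOn h (by simp)) z hz).hasFDerivWithinAt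

lemma dx_eq (h : D.SmoothOn 1 w) {z : ℝ × ℝ} (hz : z ∈ D.OmegaBar) :
    D.dx w z.1 z.2 = fderivWithin ℝ (fun z : ℝ × ℝ => w z.1 z.2) D.OmegaBar z (1, 0) := by
  have := (h.hasFDerivWithinAt hz).comp_hasDerivWithinAt (f := fun s : ℝ => (s, z.2))
    (s := Icc D.l₁ D.l₂) z.1
    ((hasDerivWithinAt_id z.1 _).prodMk (hasDerivWithinAt_const z.1 _ z.2))
    fun s hs => ⟨hs, hz.2⟩
  exact this.derivWithin (D.uniqueDiffX z.1 hz.1)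

lemma dy_eq (h : D.SmoothOn 1 w) {z : ℝ × ℝ} (hz : z ∈ D.OmegaBar) :
    D.dy w z.1 z.2 = fderivWithin ℝ (fun z : ℝ × ℝ => w z.1 z.2) D.OmegaBar z (0, 1) := by
  have := (h.hasFDerivWithinAt hz).comp_hasDerivWithinAt (f := fun s : ℝ => (z.1, s))
    (s := Icc D.l₃ D.l₄) z.2
    ((hasDerivWithinAt_const z.2 _ z.1).prodMk (hasDerivWithinAt_id z.2 _))
    fun s hs => ⟨hz.1, hs⟩
  exact this.derivWithin (D.uniqueDiffY z.2 hz.2)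

lemma SmoothOn.fderivWithin {r : ℕ∞} (h : D.SmoothOn (r + 1) w) :
    ContDiffOn ℝ r (fderivWithin ℝ (fun z : ℝ × ℝ => w z.1 z.2) D.OmegaBar) D.OmegaBar :=
  ContDiffOn.fderivWithin h D.uniqueDiffOmegaBar (by simp)

lemma SmoothOn.dx {r : ℕ∞} (h : D.SmoothOn (r + 1) w) : D.SmoothOn r (D.dx w) :=
  (h.fderivWithin.clm_apply (contDiffOn_const (c := ((1 : ℝ), (0 : ℝ))))).congr
    fun _ hz => dx_eq (h.of_le (by simp)) hz

lemma SmoothOn.dy {r : ℕ∞} (h : D.SmoothOn (r + 1) w) : D.SmoothOn r (D.dy w) :=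
  (h.fderivWithin.clm_apply (contDiffOn_const (c := ((0 : ℝ), (1 : ℝ))))).congr
    fun _ hz => dy_eq (h.of_le (by simp)) hz

lemma SmoothOn.dy_iterate {r : ℕ∞} {n : ℕ} (h : D.SmoothOn (r + n) w) :
    D.SmoothOn r (D.dy^[n] w) := by
  induction n generalizing w with
  | zero => simpa using h
  | succ n ih =>
    refine ih (SmoothOn.dy (h.of_le (le_of_eq ?_)))
    push_cast; ring

lemma dx_dy_comm (h : D.SmoothOn 2 w) : D.EqBar (D.dx (D.dy w)) (D.dy (D.dx w)) := by
  intro x hx y hy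
  have hz : (x, y) ∈ D.OmegaBar := ⟨hx, hy⟩
  have h1 : D.SmoothOn 1 w := h.of_le (by norm_num)
  have h2 : D.SmoothOn (1 + 1) w := h.of_le (by norm_num)
  have hsymm : IsSymmSndFDerivWithinAt ℝ (fun z : ℝ × ℝ => w z.1 z.2) D.OmegaBar (x, y) :=
    ContDiffWithinAt.isSymmSndFDerivWithinAt (h (x, y) hz) (by simp) D.uniqueDiffOmegaBar
      (by rw [interior_OmegaBar, closure_Omega]; exact hz) hz
  have hF : DifferentiableWithinAt ℝ
      (_root_.fderivWithin ℝ (fun z : ℝ × ℝ => w z.1 z.2) D.OmegaBar) D.OmegaBar (x, y) :=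
    h2.fderivWithin.differentiableOn (by simp) (x, y) hz
  have hderiv : ∀ e e' : ℝ × ℝ, _root_.fderivWithin ℝ (fun z : ℝ × ℝ =>
      _root_.fderivWithin ℝ (fun z : ℝ × ℝ => w z.1 z.2) D.OmegaBar z e) D.OmegaBar (x, y) e' =
      _root_.fderivWithin ℝ (_root_.fderivWithin ℝ (fun z : ℝ × ℝ => w z.1 z.2) D.OmegaBar)
        D.OmegaBar (x, y) e' e := fun e e' => by
    rw [fderivWithin_clm_apply (D.uniqueDiffOmegaBar _ hz) hF (differentiableWithinAt_const e)]
    simp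
  calc D.dx (D.dy w) x y
      = _root_.fderivWithin ℝ (fun z : ℝ × ℝ => D.dy w z.1 z.2) D.OmegaBar (x, y) (1, 0) :=
        dx_eq h2.dy hz
    _ = _root_.fderivWithin ℝ (fun z : ℝ × ℝ => D.dx w z.1 z.2) D.OmegaBar (x, y) (0, 1) := by
        rw [fderivWithin_congr (fun z hz => dy_eq h1 hz) (dy_eq h1 hz),
          fderivWithin_congr (fun z hz => dx_eq h1 hz) (dx_eq h1 hz), hderiv, hderiv]
        exact hsymm _ _
    _ = D.dy (D.dx w) x y := (dy_eq h2.dx hz).symm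

lemma dy_iterate_dx_comm {n : ℕ} (h : D.SmoothOn (n + 1) w) :
    D.EqBar (D.dy^[n] (D.dx w)) (D.dx (D.dy^[n] w)) := by
  induction n generalizing w with
  | zero => exact fun _ _ _ _ => rfl
  | succ n ih =>
    have h2 : D.SmoothOn 2 w := h.of_le (by
      have : ((1 : ℕ) : ℕ∞) ≤ ((n + 1 : ℕ) : ℕ∞) := by exact_mod_cast Nat.le_add_left 1 n
      calc (2 : ℕ∞) = ((1 : ℕ) : ℕ∞) + 1 := by norm_num
        _ ≤ _ := by gcongr)
    have h3 : D.SmoothOn (n + 1) (D.dy w) := SmoothOn.dy (h.of_le (by push_cast; rfl))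
    refine EqBar.trans ?_ (ih h3)
    exact EqBar.dy_iterate (fun x hx y hy => (dx_dy_comm h2 x hx y hy).symm) n

lemma dx_iterate_eq (w : ℝ → ℝ → ℝ) (m : ℕ) (x y : ℝ) :
    (D.dx^[m] w) x y = iteratedDerivWithin m (fun x => w x y) (Icc D.l₁ D.l₂) x := by
  induction m generalizing x with
  | zero => simp
  | succ m ih =>
    rw [iteratedDerivWithin_succ, Function.iterate_succ_apply']
    simp only [SideRect.dx]
    congr 1
    ext t; exact ih t

lemma dy_iterate_eq (w : ℝ → ℝ → ℝ) (n : ℕ) (x y : ℝ) :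
    (D.dy^[n] w) x y = iteratedDerivWithin n (fun y => w x y) (Icc D.l₃ D.l₄) y := by
  induction n generalizing y with
  | zero => simp
  | succ n ih =>
    rw [iteratedDerivWithin_succ, Function.iterate_succ_apply']
    simp only [SideRect.dy]
    congr 1
    ext t; exact ih t

lemma pd_eq_iteratedDerivWithin (w : ℝ → ℝ → ℝ) (m n : ℕ) :
    D.pd w m n = iteratedDerivWithin m (fun x => (D.dy^[n] w) x D.y₀) (Icc D.l₁ D.l₂) D.l₁ := by
  simp only [pd, dy_iterate_eq]

lemma pd_eq (w : ℝ → ℝ → ℝ) (m n : ℕ) : D.pd w m n = (D.dx^[m] (D.dy^[n] w)) D.l₁ D.y₀ := by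
  rw [pd_eq_iteratedDerivWithin, dx_iterate_eq]

lemma pd_zero_zero (w : ℝ → ℝ → ℝ) : D.pd w 0 0 = w D.l₁ D.y₀ := by simp [pd_eq]

lemma pd_congr (h : D.EqBar w v) (m n : ℕ) : D.pd w m n = D.pd v m n := by
  rw [pd_eq, pd_eq]
  exact (h.dy_iterate n).dx_iterate m _ D.l₁_mem _ D.y₀_mem

lemma pd_dy (w : ℝ → ℝ → ℝ) (m n : ℕ) : D.pd (D.dy w) m n = D.pd w m (n + 1) := by
  simp [pd_eq]

lemma pd_dx {n : ℕ} (h : D.SmoothOn (n + 1) w) (m : ℕ) :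
    D.pd (D.dx w) m n = D.pd w (m + 1) n := by
  rw [pd_eq, pd_eq, Function.iterate_succ_apply]
  exact (dy_iterate_dx_comm h).dx_iterate m _ D.l₁_mem _ D.y₀_mem

lemma SmoothOn.slice_dy {m n : ℕ} (h : D.SmoothOn (m + n : ℕ) w) :
    ContDiffOn ℝ m (fun x => (D.dy^[n] w) x D.y₀) (Icc D.l₁ D.l₂) :=
  SmoothOn.slice_x (r := m) (SmoothOn.dy_iterate (h.of_le (by push_cast; rfl))) D.y₀_mem

lemma SmoothOn.contDiffWithinAt_y {m n : ℕ} (h : D.SmoothOn (m + n : ℕ) w) {x : ℝ}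
    (hx : x ∈ Icc D.l₁ D.l₂) : ContDiffWithinAt ℝ n (fun y => w x y) (Icc D.l₃ D.l₄) D.y₀ :=
  (h.of_le (s := (n : ℕ∞)) (by exact_mod_cast Nat.le_add_left n m)).slice_y hx _ D.y₀_mem

lemma pd_add {m n : ℕ} (hw : D.SmoothOn (m + n : ℕ) w) (hv : D.SmoothOn (m + n : ℕ) v) :
    D.pd (fun x y => w x y + v x y) m n = D.pd w m n + D.pd v m n := by
  have hY : EqOn (fun x => (D.dy^[n] (fun x y => w x y + v x y)) x D.y₀)
      (fun x => (D.dy^[n] w) x D.y₀ + (D.dy^[n] v) x D.y₀) (Icc D.l₁ D.l₂) := fun x hx => by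
    simp only [dy_iterate_eq]
    exact iteratedDerivWithin_fun_add D.y₀_mem D.uniqueDiffY (hw.contDiffWithinAt_y hx)
      (hv.contDiffWithinAt_y hx)
  simp only [pd_eq_iteratedDerivWithin]
  rw [iteratedDerivWithin_congr hY D.l₁_mem]
  exact iteratedDerivWithin_fun_add D.l₁_mem D.uniqueDiffX
    (hw.slice_dy _ D.l₁_mem) (hv.slice_dy _ D.l₁_mem)

lemma pd_neg (w : ℝ → ℝ → ℝ) (m n : ℕ) :
    D.pd (fun x y => - w x y) m n = - D.pd w m n := by
  simp only [pd, iteratedDerivWithin_fun_neg]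

lemma dy_iterate_mul {m n : ℕ} (hw : D.SmoothOn (m + n : ℕ) w) (hv : D.SmoothOn (m + n : ℕ) v)
    {x : ℝ} (hx : x ∈ Icc D.l₁ D.l₂) :
    (D.dy^[n] (fun x y => w x y * v x y)) x D.y₀ = ∑ j ∈ Finset.range (n + 1),
      (n.choose j : ℝ) * ((D.dy^[j] w) x D.y₀ * (D.dy^[n - j] v) x D.y₀) := by
  simp only [dy_iterate_eq, ← mul_assoc]
  exact iteratedDerivWithin_mul D.y₀_mem D.uniqueDiffY (hw.contDiffWithinAt_y hx)
    (hv.contDiffWithinAt_y hx)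

lemma pd_mul {m n : ℕ} (hw : D.SmoothOn (m + n : ℕ) w) (hv : D.SmoothOn (m + n : ℕ) v) :
    D.pd (fun x y => w x y * v x y) m n =
      ∑ i ∈ Finset.range (m + 1), ∑ j ∈ Finset.range (n + 1),
        ((m.choose i : ℝ) * (n.choose j : ℝ)) * (D.pd w i j * D.pd v (m - i) (n - j)) := by
  have hslice : ∀ {u : ℝ → ℝ → ℝ} (_ : D.SmoothOn (m + n : ℕ) u) {j : ℕ} (_ : j ≤ n),
      ContDiffWithinAt ℝ m (fun x => (D.dy^[j] u) x D.y₀) (Icc D.l₁ D.l₂) D.l₁ := fun hu j hj =>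
    (hu.of_le (s := (m + j : ℕ)) (by exact_mod_cast (by omega))).slice_dy _ D.l₁_mem
  have hw' : ∀ j ∈ Finset.range (n + 1), ContDiffWithinAt ℝ m (fun x => (D.dy^[j] w) x D.y₀)
      (Icc D.l₁ D.l₂) D.l₁ := fun j hj => hslice hw (Finset.mem_range_succ_iff.1 hj)
  have hv' : ∀ j : ℕ, ContDiffWithinAt ℝ m (fun x => (D.dy^[n - j] v) x D.y₀)
      (Icc D.l₁ D.l₂) D.l₁ := fun j => hslice hv (Nat.sub_le n j)
  rw [pd_eq_iteratedDerivWithin,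
    iteratedDerivWithin_congr (fun x hx => dy_iterate_mul hw hv hx) D.l₁_mem,
    iteratedDerivWithin_fun_sum D.l₁_mem D.uniqueDiffX
      fun j hj => contDiffWithinAt_const.mul ((hw' j hj).mul (hv' j)), Finset.sum_comm]
  refine Finset.sum_congr rfl fun j hj => ?_
  rw [iteratedDerivWithin_const_mul_field]
  refine (congrArg _ (iteratedDerivWithin_mul D.l₁_mem D.uniqueDiffX (hw' j hj) (hv' j))).trans ?_
  simp only [pd_eq_iteratedDerivWithin, Finset.mul_sum]
  exact Finset.sum_congr rfl fun i _ => by ring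

lemma SmoothOn.sum {ι : Type*} (s : Finset ι) {W : ι → ℝ → ℝ → ℝ} {r : ℕ∞}
    (h : ∀ i ∈ s, D.SmoothOn r (W i)) : D.SmoothOn r (fun x y => ∑ i ∈ s, W i x y) :=
  ContDiffOn.sum (f := fun i (z : ℝ × ℝ) => W i z.1 z.2) h

lemma pd_sum {ι : Type*} (s : Finset ι) {W : ι → ℝ → ℝ → ℝ} {m n : ℕ}
    (h : ∀ i ∈ s, D.SmoothOn (m + n : ℕ) (W i)) :
    D.pd (fun x y => ∑ i ∈ s, W i x y) m n = ∑ i ∈ s, D.pd (W i) m n := by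
  classical
  induction s using Finset.induction_on with
  | empty => simp [pd]
  | insert i s hi ih =>
    simp only [Finset.sum_insert hi]
    rw [pd_add (h i (Finset.mem_insert_self i s))
      (SmoothOn.sum s fun j hj => h j (Finset.mem_insert_of_mem hj)),
      ih fun j hj => h j (Finset.mem_insert_of_mem hj)]

lemma pd_const_mul (c : ℝ) (w : ℝ → ℝ → ℝ) (m n : ℕ) :
    D.pd (fun x y => c * w x y) m n = c * D.pd w m n := by
  simp only [pd, iteratedDerivWithin_const_mul_field]

lemma iteratedDerivWithin_sub_pow {s : Set ℝ} {c : ℝ} (hs : UniqueDiffOn ℝ s) (hc : c ∈ s)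
    (k i : ℕ) :
    iteratedDerivWithin i (fun x => (x - c) ^ k) s c = if i = k then (k.factorial : ℝ) else 0 := by
  rw [iteratedDerivWithin_eq_iteratedDeriv hs (by fun_prop) hc,
    iteratedDeriv_comp_sub_const i (fun x : ℝ => x ^ k) c]
  simpa using iteratedDeriv_fun_pow_zero (𝕜 := ℝ) (n := i) (m := k)

end SideRect

/-- The divided monomial `x^m y^n / (m! n!)` with the exponents `p = (m, n)`. -/
noncomputable def divMonomial (p : ℕ × ℕ) (x y : ℝ) : ℝ :=
  x ^ p.1 * y ^ p.2 / ((p.1.factorial : ℝ) * (p.2.factorial : ℝ))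

lemma SideRect.pd_divMonomial {D : SideRect} (p : ℕ × ℕ) (m n : ℕ) :
    D.pd (fun x y => divMonomial p (x - D.l₁) (y - D.y₀)) m n = kron p.1 p.2 m n := by
  have hsplit : ∀ x y : ℝ, divMonomial p (x - D.l₁) (y - D.y₀) =
      ((x - D.l₁) ^ p.1 / ((p.1.factorial : ℝ) * (p.2.factorial : ℝ))) * (y - D.y₀) ^ p.2 :=
    fun x y => mul_div_right_comm _ _ _
  simp only [pd, hsplit, iteratedDerivWithin_const_mul_field, div_eq_mul_inv,
    iteratedDerivWithin_mul_const_field, iteratedDerivWithin_sub_pow D.uniqueDiffX D.l₁_mem,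
    iteratedDerivWithin_sub_pow D.uniqueDiffY D.y₀_mem, kron, ite_and]
  split_ifs <;> simp
  field_simp

/-- The homogeneous part of degree `d` of the Taylor polynomial with the partial derivatives `J`. -/
noncomputable def homogPart (J : ℕ → ℕ → ℝ) (d : ℕ) (x y : ℝ) : ℝ :=
  ∑ p ∈ antidiagonal d, J p.1 p.2 * divMonomial p x y

/-- The Taylor polynomial of degree `N` with the partial derivatives `J`. -/
noncomputable def jetPoly (J : ℕ → ℕ → ℝ) (N : ℕ) (x y : ℝ) : ℝ :=
  ∑ p ∈ Lam N, J p.1 p.2 * divMonomial p x y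

lemma mem_Lam {K : ℕ} {p : ℕ × ℕ} : p ∈ Lam K ↔ p.1 + p.2 ≤ K := by
  simp only [Lam, Finset.mem_filter, Finset.mem_product, Finset.mem_range]
  omega

lemma jetPoly_eq_sum (J : ℕ → ℕ → ℝ) (N : ℕ) (x y : ℝ) :
    jetPoly J N x y = ∑ d ∈ Finset.range (N + 1), homogPart J d x y := by
  rw [jetPoly, ← Finset.sum_fiberwise_of_maps_to (s := Lam N) (t := Finset.range (N + 1))
    (g := fun p => p.1 + p.2) (fun p hp => Finset.mem_range.2 (by have := mem_Lam.1 hp; omega))]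
  refine Finset.sum_congr rfl fun d hd => ?_
  refine Finset.sum_congr ?_ fun _ _ => rfl
  ext p
  have := Finset.mem_range.1 hd
  simp only [Finset.mem_filter, mem_Lam, Finset.HasAntidiagonal.mem_antidiagonal]
  omega

lemma divMonomial_mul (p : ℕ × ℕ) (x y h : ℝ) :
    divMonomial p (x * h) (y * h) = h ^ (p.1 + p.2) * divMonomial p x y := by
  simp only [divMonomial]
  ring

lemma homogPart_mul (J : ℕ → ℕ → ℝ) (d : ℕ) (x y h : ℝ) :
    homogPart J d (x * h) (y * h) = h ^ d * homogPart J d x y := by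
  rw [homogPart, homogPart, Finset.mul_sum]
  refine Finset.sum_congr rfl fun p hp => ?_
  rw [divMonomial_mul, Finset.HasAntidiagonal.mem_antidiagonal.1 hp, mul_left_comm]

lemma choose_mul_eq_factorial_mul_divMonomial (p : ℕ × ℕ) (x y : ℝ) :
    ((p.1 + p.2).choose p.1 : ℝ) * (x ^ p.1 * y ^ p.2)
      = ((p.1 + p.2).factorial : ℝ) * divMonomial p x y := by
  have h : ((p.1 + p.2).choose p.1 : ℝ) * p.1.factorial * p.2.factorial
      = (p.1 + p.2).factorial := by
    rw [Nat.choose_symm_add]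
    exact_mod_cast Nat.add_choose_mul_factorial_mul_factorial p.1 p.2
  rw [divMonomial, ← h]
  field_simp

namespace SideRect

variable {D : SideRect} {w v : ℝ → ℝ → ℝ}

/-- The segment `t ↦ P + t (k, l)`, `0 ≤ t ≤ b`, lies in the closed rectangle. -/
def RayIn (D : SideRect) (k l b : ℝ) : Prop :=
  ∀ t ∈ Icc 0 b, D.l₁ + k * t ∈ Icc D.l₁ D.l₂ ∧ D.y₀ + l * t ∈ Icc D.l₃ D.l₄

lemma exists_rayIn {k : ℝ} (hk : 0 ≤ k) (l : ℝ) : ∃ b > 0, D.RayIn k l b := by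
  have hx : ∀ᶠ t in 𝓝[>] 0, D.l₁ + k * t < D.l₂ :=
    (((by fun_prop : Continuous fun t => D.l₁ + k * t).tendsto' 0 D.l₁ (by simp)).eventually
      (gt_mem_nhds D.hx)).filter_mono nhdsWithin_le_nhds
  have hy : ∀ᶠ t in 𝓝[>] 0, D.y₀ + l * t ∈ Ioo D.l₃ D.l₄ :=
    (((by fun_prop : Continuous fun t => D.y₀ + l * t).tendsto' 0 D.y₀ (by simp)).eventually
      (Ioo_mem_nhds D.hy₃ D.hy₄)).filter_mono nhdsWithin_le_nhds
  obtain ⟨b, ⟨hbx, hby⟩, hb⟩ := ((hx.and hy).and self_mem_nhdsWithin).exists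
  have hb : 0 < b := hb
  have hconv : ∀ t ∈ Icc 0 b, D.y₀ + l * t ∈ Icc D.l₃ D.l₄ := fun t ht => by
    have := (convex_Icc D.l₃ D.l₄).add_smul_mem D.y₀_mem
      (show D.y₀ + l * b ∈ Icc D.l₃ D.l₄ from Ioo_subset_Icc_self hby)
      (t := t / b) ⟨div_nonneg ht.1 hb.le, (div_le_one hb).2 ht.2⟩
    rwa [smul_eq_mul, show t / b * (l * b) = l * t by field_simp] at this
  exact ⟨b, hb, fun t ht => ⟨⟨le_add_of_nonneg_right (mul_nonneg hk ht.1),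
    (add_le_add_right (mul_le_mul_of_nonneg_left ht.2 hk) _).trans hbx.le⟩, hconv t ht⟩⟩

variable {k l b : ℝ}

lemma SmoothOn.ray {r : ℕ∞} (hw : D.SmoothOn r w) (hr : D.RayIn k l b) :
    ContDiffOn ℝ r (fun t => w (D.l₁ + k * t) (D.y₀ + l * t)) (Icc 0 b) :=
  ContDiffOn.comp hw (t := D.OmegaBar) (g := fun z : ℝ × ℝ => w z.1 z.2)
    (f := fun t => (D.l₁ + k * t, D.y₀ + l * t)) (by fun_prop) hr

lemma SmoothOn.hasDerivWithinAt_ray (hw : D.SmoothOn 1 w) (hr : D.RayIn k l b) {t : ℝ}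
    (ht : t ∈ Icc 0 b) :
    HasDerivWithinAt (fun t => w (D.l₁ + k * t) (D.y₀ + l * t))
      (k * D.dx w (D.l₁ + k * t) (D.y₀ + l * t) + l * D.dy w (D.l₁ + k * t) (D.y₀ + l * t))
      (Icc 0 b) t := by
  have hz : (D.l₁ + k * t, D.y₀ + l * t) ∈ D.OmegaBar := hr t ht
  have h1 : HasDerivWithinAt (fun t : ℝ => (D.l₁ + k * t, D.y₀ + l * t)) (k, l) (Icc 0 b) t := by
    simpa using (((hasDerivWithinAt_id t _).const_mul k).const_add D.l₁).prodMk
      (((hasDerivWithinAt_id t _).const_mul l).const_add D.y₀)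
  have := (hw.hasFDerivWithinAt hz).comp_hasDerivWithinAt t h1 fun t ht => hr t ht
  have ex := dx_eq hw hz
  have ey := dy_eq hw hz
  dsimp only at ex ey
  rw [ex, ey]
  rw [show ((k, l) : ℝ × ℝ) = k • (1, 0) + l • (0, 1) by simp, map_add, map_smul, map_smul] at this
  exact this

lemma iteratedDerivWithin_ray {j : ℕ} (hw : D.SmoothOn j w) (hr : D.RayIn k l b) (hb : 0 < b) :
    iteratedDerivWithin j (fun t => w (D.l₁ + k * t) (D.y₀ + l * t)) (Icc 0 b) 0
      = ∑ p ∈ antidiagonal j,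
        (j.choose p.1 : ℝ) * (k ^ p.1 * l ^ p.2 * D.pd w p.1 p.2) := by
  have h0 : (0 : ℝ) ∈ Icc 0 b := left_mem_Icc.2 hb.le
  have hu := uniqueDiffOn_Icc hb
  induction j generalizing w with
  | zero => simp [pd_zero_zero]
  | succ j ih =>
    have h1 : D.SmoothOn 1 w := hw.of_le (by exact_mod_cast Nat.le_add_left 1 j)
    have hx : D.SmoothOn j (D.dx w) := SmoothOn.dx (hw.of_le (by push_cast; rfl))
    have hy : D.SmoothOn j (D.dy w) := SmoothOn.dy (hw.of_le (by push_cast; rfl))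
    have e : EqOn (derivWithin (fun t => w (D.l₁ + k * t) (D.y₀ + l * t)) (Icc 0 b))
        (fun t => k * D.dx w (D.l₁ + k * t) (D.y₀ + l * t)
          + l * D.dy w (D.l₁ + k * t) (D.y₀ + l * t)) (Icc 0 b) := fun t ht =>
      (h1.hasDerivWithinAt_ray hr ht).derivWithin (hu t ht)
    rw [iteratedDerivWithin_succ', iteratedDerivWithin_congr e h0, iteratedDerivWithin_fun_add h0 hu
      (contDiffWithinAt_const.mul (hx.ray hr 0 h0)) (contDiffWithinAt_const.mul (hy.ray hr 0 h0)),
      iteratedDerivWithin_const_mul_field, iteratedDerivWithin_const_mul_field, ih hx, ih hy,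
      Finset.sum_antidiagonal_choose_succ_mul (fun p q => k ^ p * l ^ q * D.pd w p q), add_comm,
      Finset.mul_sum, Finset.mul_sum]
    congr 1
    · refine Finset.sum_congr rfl fun p _ => ?_
      rw [pd_dy]; ring
    · refine Finset.sum_congr rfl fun p hp => ?_
      have hp' := Finset.HasAntidiagonal.mem_antidiagonal.1 hp
      rw [pd_dx (hw.of_le (by exact_mod_cast (by omega))), Nat.choose_symm_of_eq_add hp'.symm]
      ring

lemma taylorWithinEval_ray {N : ℕ} (hw : D.SmoothOn N w) (hr : D.RayIn k l b) (hb : 0 < b)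
    (h : ℝ) :
    taylorWithinEval (fun t => w (D.l₁ + k * t) (D.y₀ + l * t)) N (Icc 0 b) 0 h
      = jetPoly (D.pd w) N (k * h) (l * h) := by
  rw [taylor_within_apply, jetPoly_eq_sum]
  refine Finset.sum_congr rfl fun d hd => ?_
  rw [homogPart_mul, iteratedDerivWithin_ray (hw.of_le (by
      exact_mod_cast Nat.lt_succ_iff.1 (Finset.mem_range.1 hd))) hr hb, smul_eq_mul, homogPart,
    sub_zero, mul_comm ((d.factorial : ℝ)⁻¹), mul_assoc, Finset.mul_sum]
  congr 1
  refine Finset.sum_congr rfl fun p hp => ?_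
  rw [← Finset.HasAntidiagonal.mem_antidiagonal.1 hp, ← mul_assoc (Nat.choose _ _ : ℝ),
    choose_mul_eq_factorial_mul_divMonomial]
  field_simp

lemma taylor_ray {N : ℕ} (hw : D.SmoothOn (N + 1 : ℕ) w) (hk : 0 ≤ k) (l : ℝ) :
    (fun h : ℝ => w (D.l₁ + k * h) (D.y₀ + l * h) - jetPoly (D.pd w) N (k * h) (l * h))
      =O[𝓝[>] 0] fun h : ℝ => h ^ (N + 1) := by
  obtain ⟨b, hb, hr⟩ := exists_rayIn (D := D) hk l
  obtain ⟨C, hC⟩ := exists_taylor_mean_remainder_bound (n := N) hb.le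
    ((hw.ray hr).of_le (by push_cast; rfl))
  refine IsBigO.of_bound C ?_
  filter_upwards [Ioc_mem_nhdsGT hb] with h hh
  have hbound := hC h ⟨hh.1.le, hh.2⟩
  rw [taylorWithinEval_ray (hw.of_le (by exact_mod_cast Nat.le_succ N)) hr hb, sub_zero] at hbound
  rwa [Real.norm_of_nonneg (pow_nonneg hh.1.le _)]

end SideRect

/-! ### The differential equation up to the boundary -/

namespace SideRect

variable {D : SideRect} {w : ℝ → ℝ → ℝ}

lemma hasDerivAt_dx (hw : D.SmoothOn 1 w) {x y : ℝ} (hx : x ∈ Ioo D.l₁ D.l₂)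
    (hy : y ∈ Icc D.l₃ D.l₄) : HasDerivAt (fun s => w s y) (D.dx w x y) x :=
  (((hw.slice_x hy).differentiableOn (by simp) x
    (Ioo_subset_Icc_self hx)).hasDerivWithinAt).hasDerivAt (Icc_mem_nhds hx.1 hx.2)

lemma hasDerivAt_dy (hw : D.SmoothOn 1 w) {x y : ℝ} (hx : x ∈ Icc D.l₁ D.l₂)
    (hy : y ∈ Ioo D.l₃ D.l₄) : HasDerivAt (fun t => w x t) (D.dy w x y) y :=
  (((hw.slice_y hx).differentiableOn (by simp) y
    (Ioo_subset_Icc_self hy)).hasDerivWithinAt).hasDerivAt (Icc_mem_nhds hy.1 hy.2)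

variable {a u f : ℝ → ℝ → ℝ}

/-- The operator `-∇·(a∇u)`, expanded by the product rule and with one-sided derivatives, so that it
makes sense on the closed rectangle. -/
noncomputable def negDivGrad (D : SideRect) (a u : ℝ → ℝ → ℝ) (x y : ℝ) : ℝ :=
  - (D.dx a x y * D.dx u x y + a x y * D.dx (D.dx u) x y
    + (D.dy a x y * D.dy u x y + a x y * D.dy (D.dy u) x y))

lemma negDivGrad_eq (ha : D.SmoothOn 1 a) (hu : D.SmoothOn 2 u) {x y : ℝ}
    (hx : x ∈ Ioo D.l₁ D.l₂) (hy : y ∈ Ioo D.l₃ D.l₄) :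
    -(deriv (fun s => a s y * deriv (fun t => u t y) s) x
        + deriv (fun s => a x s * deriv (fun t => u x t) s) y) = D.negDivGrad a u x y := by
  have hx' := Ioo_subset_Icc_self hx
  have hy' := Ioo_subset_Icc_self hy
  have hu1 : D.SmoothOn 1 u := hu.of_le (by norm_num)
  have hu2 : D.SmoothOn (1 + 1) u := hu.of_le (by norm_num)
  have hflux_x : (fun s => a s y * deriv (fun t => u t y) s) =ᶠ[𝓝 x]
      fun s => a s y * D.dx u s y := by
    filter_upwards [Ioo_mem_nhds hx.1 hx.2] with s hs
    rw [(hasDerivAt_dx hu1 hs hy').deriv]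
  have hflux_y : (fun s => a x s * deriv (fun t => u x t) s) =ᶠ[𝓝 y]
      fun s => a x s * D.dy u x s := by
    filter_upwards [Ioo_mem_nhds hy.1 hy.2] with s hs
    rw [(hasDerivAt_dy hu1 hx' hs).deriv]
  rw [hflux_x.deriv_eq, hflux_y.deriv_eq, negDivGrad,
    ((hasDerivAt_dx ha hx hy').fun_mul (hasDerivAt_dx hu2.dx hx hy')).deriv,
    ((hasDerivAt_dy ha hx' hy).fun_mul (hasDerivAt_dy hu2.dy hx' hy)).deriv]

lemma SmoothOn.negDivGrad {r : ℕ∞} (ha : D.SmoothOn (r + 1) a) (hu : D.SmoothOn (r + 1 + 1) u) :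
    D.SmoothOn r (D.negDivGrad a u) := by
  have hu' : D.SmoothOn (r + 1) u := hu.of_le (by simp)
  have ha' : D.SmoothOn r a := ha.of_le (by simp)
  exact (((ha.dx.mul hu'.dx).add (ha'.mul hu.dx.dx)).add
    ((ha.dy.mul hu'.dy).add (ha'.mul hu.dy.dy))).neg

lemma negDivGrad_eqBar (ha : D.SmoothOn 1 a) (hu : D.SmoothOn 2 u) (hf : D.SmoothOn 0 f)
    (h : ∀ x ∈ Ioo D.l₁ D.l₂, ∀ y ∈ Ioo D.l₃ D.l₄,
    -(deriv (fun s => a s y * deriv (fun t => u t y) s) x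
        + deriv (fun s => a x s * deriv (fun t => u x t) s) y) = f x y) :
    D.EqBar (D.negDivGrad a u) f := by
  have hc : D.SmoothOn 0 (D.negDivGrad a u) :=
    SmoothOn.negDivGrad (ha.of_le (by norm_num)) (hu.of_le (by norm_num))
  have heq : EqOn (fun z : ℝ × ℝ => D.negDivGrad a u z.1 z.2) (fun z => f z.1 z.2) D.OmegaBar := by
    refine EqOn.of_subset_closure (s := D.Omega) (fun z hz => ?_) (ContDiffOn.continuousOn hc)
      (ContDiffOn.continuousOn hf) ?_ D.closure_Omega.ge
    · rw [← negDivGrad_eq ha hu hz.1 hz.2, h _ hz.1 _ hz.2]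
    · rw [← D.closure_Omega]; exact subset_closure
  exact fun x hx y hy => heq (x := (x, y)) ⟨hx, hy⟩

lemma SmoothOn.log {r : ℕ∞} (ha : D.SmoothOn r a) (ha₀ : ∀ z ∈ D.OmegaBar, a z.1 z.2 ≠ 0) :
    D.SmoothOn r (fun x y => Real.log (a x y)) :=
  ContDiffOn.log ha ha₀

lemma SmoothOn.inv {r : ℕ∞} (ha : D.SmoothOn r a) (ha₀ : ∀ z ∈ D.OmegaBar, a z.1 z.2 ≠ 0) :
    D.SmoothOn r (fun x y => (a x y)⁻¹) :=
  ContDiffOn.inv ha ha₀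

-- Since `Real.log a` is `log |a|`, its gradient is `∇a / a` also where `a` is negative.
lemma dx_log (ha : D.SmoothOn 1 a) (ha₀ : ∀ z ∈ D.OmegaBar, a z.1 z.2 ≠ 0) :
    D.EqBar (D.dx fun x y => Real.log (a x y)) (fun x y => D.dx a x y / a x y) :=
  fun x hx y hy => derivWithin.log ((ha.slice_x hy).differentiableOn (by simp) x hx)
    (ha₀ (x, y) ⟨hx, hy⟩) (D.uniqueDiffX x hx)

lemma dy_log (ha : D.SmoothOn 1 a) (ha₀ : ∀ z ∈ D.OmegaBar, a z.1 z.2 ≠ 0) :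
    D.EqBar (D.dy fun x y => Real.log (a x y)) (fun x y => D.dy a x y / a x y) :=
  fun x hx y hy => derivWithin.log ((ha.slice_y hx).differentiableOn (by simp) y hy)
    (ha₀ (x, y) ⟨hx, hy⟩) (D.uniqueDiffY y hy)

lemma dx_dx_eqBar_of_pde (ha : D.SmoothOn 1 a) (ha₀ : ∀ z ∈ D.OmegaBar, a z.1 z.2 ≠ 0)
    (h : D.EqBar (D.negDivGrad a u) f) :
    D.EqBar (D.dx (D.dx u)) (fun x y => - D.dy (D.dy u) x y +
      - ((D.dx (fun x y => Real.log (a x y)) x y * D.dx u x y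
        + D.dy (fun x y => Real.log (a x y)) x y * D.dy u x y) + (a x y)⁻¹ * f x y)) := by
  intro x hx y hy
  have hne : a x y ≠ 0 := ha₀ (x, y) ⟨hx, hy⟩
  dsimp only
  rw [dx_log ha ha₀ x hx y hy, dy_log ha ha₀ x hx y hy, ← h x hx y hy, negDivGrad]
  field_simp
  ring

lemma pd_dx_mul_dx {m n : ℕ} (hw : D.SmoothOn (m + n + 1 : ℕ) w)
    (hu : D.SmoothOn (m + n + 1 : ℕ) u) :
    D.pd (fun x y => D.dx w x y * D.dx u x y) m n =
      ∑ i ∈ Finset.range (m + 1), ∑ j ∈ Finset.range (n + 1),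
        ((m.choose i : ℝ) * (n.choose j : ℝ)) *
          (D.pd w (i + 1) j * D.pd u (m - i + 1) (n - j)) := by
  rw [pd_mul (SmoothOn.dx (hw.of_le (by norm_cast))) (SmoothOn.dx (hu.of_le (by norm_cast)))]
  refine Finset.sum_congr rfl fun i _ => Finset.sum_congr rfl fun j hj => ?_
  have hj := Finset.mem_range.1 hj
  rw [pd_dx (hw.of_le (by exact_mod_cast (by omega))),
    pd_dx (hu.of_le (by exact_mod_cast (by omega)))]

lemma pd_dy_mul_dy {m n : ℕ} (hw : D.SmoothOn (m + n + 1 : ℕ) w)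
    (hu : D.SmoothOn (m + n + 1 : ℕ) u) :
    D.pd (fun x y => D.dy w x y * D.dy u x y) m n =
      ∑ i ∈ Finset.range (m + 1), ∑ j ∈ Finset.range (n + 1),
        ((m.choose i : ℝ) * (n.choose j : ℝ)) *
          (D.pd w i (j + 1) * D.pd u (m - i) (n - j + 1)) := by
  rw [pd_mul (SmoothOn.dy (hw.of_le (by norm_cast))) (SmoothOn.dy (hu.of_le (by norm_cast)))]
  simp only [pd_dy]

lemma pd_add_two (ha₀ : ∀ z ∈ D.OmegaBar, a z.1 z.2 ≠ 0) {m n : ℕ}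
    (ha : D.SmoothOn (m + n + 1 : ℕ) a) (hu : D.SmoothOn (m + n + 2 : ℕ) u)
    (hf : D.SmoothOn (m + n : ℕ) f) (h : D.EqBar (D.negDivGrad a u) f) :
    D.pd u (m + 2) n = - D.pd u m (n + 2)
      - ∑ i ∈ Finset.range (m + 1), ∑ j ∈ Finset.range (n + 1),
          ((m.choose i : ℝ) * (n.choose j : ℝ)) *
            (D.pd (fun x y => Real.log (a x y)) (i + 1) j * D.pd u (m - i + 1) (n - j)
              + D.pd (fun x y => Real.log (a x y)) i (j + 1) * D.pd u (m - i) (n - j + 1)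
              + D.pd (fun x y => (a x y)⁻¹) i j * D.pd f (m - i) (n - j)) := by
  have hL := ha.log ha₀
  have hR := SmoothOn.inv (ha.of_le (s := (m + n : ℕ)) (by exact_mod_cast (by omega))) ha₀
  have hu1 : D.SmoothOn (m + n + 1 : ℕ) u := hu.of_le (by exact_mod_cast (by omega))
  have hux : D.SmoothOn (m + n + 1 : ℕ) (D.dx u) := SmoothOn.dx (hu.of_le (by norm_cast))
  have huy : D.SmoothOn (m + n + 1 : ℕ) (D.dy u) := SmoothOn.dy (hu.of_le (by norm_cast))
  have huyy : D.SmoothOn (m + n : ℕ) (D.dy (D.dy u)) := SmoothOn.dy (huy.of_le (by norm_cast))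
  have hdx {v : ℝ → ℝ → ℝ} (hv : D.SmoothOn (m + n + 1 : ℕ) v) : D.SmoothOn (m + n : ℕ) (D.dx v) :=
    SmoothOn.dx (hv.of_le (by norm_cast))
  have hdy {v : ℝ → ℝ → ℝ} (hv : D.SmoothOn (m + n + 1 : ℕ) v) : D.SmoothOn (m + n : ℕ) (D.dy v) :=
    SmoothOn.dy (hv.of_le (by norm_cast))
  have hX := (hdx hL).mul (hdx hu1)
  have hY := (hdy hL).mul (hdy hu1)
  calc D.pd u (m + 2) n
      = D.pd (D.dx (D.dx u)) m n := by
        rw [pd_dx (hux.of_le (by exact_mod_cast (by omega))),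
          pd_dx (hu.of_le (by exact_mod_cast (by omega)))]
    _ = _ := by
        rw [pd_congr (dx_dx_eqBar_of_pde (ha.of_le (by exact_mod_cast (by omega))) ha₀ h),
          pd_add huyy.neg ((hX.add hY).add (hR.mul hf)).neg, pd_neg, pd_dy, pd_dy, pd_neg,
          pd_add (hX.add hY) (hR.mul hf), pd_add hX hY, pd_dx_mul_dx hL hu1, pd_dy_mul_dy hL hu1,
          pd_mul hR hf, sub_eq_add_neg]
        simp only [← Finset.sum_add_distrib, mul_add]

/-! ### The boundary condition -/

lemma bd_eq_iteratedDerivWithin {b : ℝ → ℝ} {n : ℕ} (hb : D.SmoothSide n b) :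
    D.bd b n = iteratedDerivWithin n b (Icc D.l₃ D.l₄) D.y₀ :=
  (iteratedDerivWithin_eq_iteratedDeriv D.uniqueDiffY
    (hb.contDiffAt (Icc_mem_nhds D.hy₃ D.hy₄)) D.y₀_mem).symm

lemma pd_zero_left (w : ℝ → ℝ → ℝ) (n : ℕ) :
    D.pd w 0 n = iteratedDerivWithin n (fun y => w D.l₁ y) (Icc D.l₃ D.l₄) D.y₀ := by
  simp [pd]

lemma bd_robin {α g : ℝ → ℝ} {n : ℕ} (hα : D.SmoothSide n α) (hu : D.SmoothOn (n + 1 : ℕ) u)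
    (hg : ∀ y ∈ Ioo D.l₃ D.l₄, D.robin α u y = g y) :
    D.bd g n = - D.pd u 1 n
      + ∑ i ∈ Finset.range (n + 1), (n.choose i : ℝ) * D.bd α (n - i) * D.pd u 0 i := by
  have hun : D.SmoothOn n u := hu.of_le (by exact_mod_cast (by omega))
  have hux : ContDiffOn ℝ n (fun y => - D.dx u D.l₁ y) (Icc D.l₃ D.l₄) :=
    (SmoothOn.slice_y (SmoothOn.dx (hu.of_le (by norm_cast))) D.l₁_mem).neg
  have hu₁ : ContDiffOn ℝ n (fun y => u D.l₁ y) (Icc D.l₃ D.l₄) := hun.slice_y D.l₁_mem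
  have hα' : ContDiffOn ℝ n α (Icc D.l₃ D.l₄) := hα
  have hg' : g =ᶠ[𝓝 D.y₀] fun y => - D.dx u D.l₁ y + u D.l₁ y * α y := by
    filter_upwards [Ioo_mem_nhds D.hy₃ D.hy₄] with y hy
    rw [← hg y hy, robin, mul_comm]; rfl
  rw [bd, hg'.iteratedDeriv_eq, ← iteratedDerivWithin_eq_iteratedDeriv D.uniqueDiffY
    ((hux.add (hu₁.mul hα')).contDiffAt (Icc_mem_nhds D.hy₃ D.hy₄)) D.y₀_mem,
    iteratedDerivWithin_fun_add D.y₀_mem D.uniqueDiffY (hux _ D.y₀_mem)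
      ((hu₁.mul hα') _ D.y₀_mem), iteratedDerivWithin_fun_neg, ← pd_zero_left, pd_dx
      (hu.of_le (by norm_cast))]
  congr 1
  refine (iteratedDerivWithin_mul D.y₀_mem D.uniqueDiffY (hu₁ _ D.y₀_mem)
    (hα' _ D.y₀_mem)).trans (Finset.sum_congr rfl fun i _ => ?_)
  rw [bd_eq_iteratedDerivWithin (ContDiffOn.of_le hα (by exact_mod_cast Nat.sub_le n i)),
    pd_zero_left]
  ring

end SideRect

/-! ### Formal solutions of the differential equation -/

/-- The array `J` of partial derivatives satisfies, up to order `N`, the recursion obtained by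
differentiating the equation; `L`, `R` and `F` are the derivatives of `log a`, `1 / a` and `f`, as
in `formalJet`. -/
def IsJet (L R F : ℕ → ℕ → ℝ) (N : ℕ) (J : ℕ → ℕ → ℝ) : Prop :=
  ∀ m n, m + n + 2 ≤ N → J (m + 2) n = - J m (n + 2)
      - ∑ i ∈ Finset.range (m + 1), ∑ j ∈ Finset.range (n + 1),
          ((m.choose i : ℝ) * (n.choose j : ℝ)) *
            (L (i + 1) j * J (m - i + 1) (n - j) + L i (j + 1) * J (m - i) (n - j + 1)
              + R i j * F (m - i) (n - j))

section Jets

variable {L R F F' φ J J' : ℕ → ℕ → ℝ} {N : ℕ}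

lemma formalJet_zero (n : ℕ) : formalJet L R φ F 0 n = φ 0 n := by rw [formalJet]

lemma formalJet_one (n : ℕ) : formalJet L R φ F 1 n = φ 1 n := by rw [formalJet]

lemma isJet_formalJet (N : ℕ) : IsJet L R F N (formalJet L R φ F) := fun m n _ => by
  rw [formalJet]

lemma IsJet.mono {M : ℕ} (h : IsJet L R F N J) (hM : M ≤ N) : IsJet L R F M J :=
  fun m n hmn => h m n (hmn.trans hM)

lemma IsJet.unique (hJ : IsJet L R F N J) (hJ' : IsJet L R F' N J')
    (hF : ∀ m n, m + n + 2 ≤ N → F m n = F' m n) (h0 : ∀ n, n ≤ N → J 0 n = J' 0 n)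
    (h1 : ∀ n, n + 1 ≤ N → J 1 n = J' 1 n) : ∀ m n, m + n ≤ N → J m n = J' m n := by
  intro m
  induction m using Nat.strong_induction_on with
  | _ m ih =>
    intro n hmn
    match m, ih, hmn with
    | 0, _, hmn => exact h0 n (by omega)
    | 1, _, hmn => exact h1 n (by omega)
    | m + 2, ih, hmn =>
      rw [hJ m n (by omega), hJ' m n (by omega), ih m (by omega) (n + 2) (by omega)]
      congr 1
      refine Finset.sum_congr rfl fun i hi => Finset.sum_congr rfl fun j hj => ?_
      have hi' := Finset.mem_range.1 hi
      have hj' := Finset.mem_range.1 hj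
      rw [ih (m - i + 1) (by omega) (n - j) (by omega),
        ih (m - i) (by omega) (n - j + 1) (by omega), hF (m - i) (n - j) (by omega)]

lemma isJet_zero : IsJet L R (fun _ _ => 0) N (fun _ _ => 0) := fun m n _ => by simp

lemma IsJet.add (h : IsJet L R F N J) (h' : IsJet L R F' N J') :
    IsJet L R (fun m n => F m n + F' m n) N (fun m n => J m n + J' m n) := fun m n hmn => by
  simp only [h m n hmn, h' m n hmn]
  have : ∀ A B C D E : ℝ, E = C + D → -A - C + (-B - D) = -(A + B) - E := by
    intros; linarith
  refine this _ _ _ _ _ ?_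
  simp only [← Finset.sum_add_distrib]
  refine Finset.sum_congr rfl fun i _ => Finset.sum_congr rfl fun j _ => ?_
  ring

lemma IsJet.const_mul (c : ℝ) (h : IsJet L R F N J) :
    IsJet L R (fun m n => c * F m n) N (fun m n => c * J m n) := fun m n hmn => by
  simp only [h m n hmn]
  have : ∀ A C E : ℝ, E = c * C → c * (-A - C) = -(c * A) - E := by
    rintro A C E rfl; ring
  refine this _ _ _ ?_
  simp only [Finset.mul_sum]
  refine Finset.sum_congr rfl fun i _ => Finset.sum_congr rfl fun j _ => ?_
  ring

lemma IsJet.sum {ι : Type*} (s : Finset ι) (c : ι → ℝ) {F J : ι → ℕ → ℕ → ℝ}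
    (h : ∀ i ∈ s, IsJet L R (F i) N (J i)) :
    IsJet L R (fun m n => ∑ i ∈ s, c i * F i m n) N (fun m n => ∑ i ∈ s, c i * J i m n) := by
  classical
  induction s using Finset.induction_on with
  | empty => simpa using isJet_zero
  | insert i s hi ih =>
    simp only [Finset.sum_insert hi]
    exact ((h i (Finset.mem_insert_self i s)).const_mul (c i)).add
      (ih fun j hj => h j (Finset.mem_insert_of_mem hj))

lemma IsJet.eq_zero_of_lt {d : ℕ} (h : IsJet L R F N J) (hF : ∀ m n, m + n + 2 < d → F m n = 0)
    (h0 : ∀ n, n < d → J 0 n = 0) (h1 : ∀ n, n + 1 < d → J 1 n = 0) (m n : ℕ) (hmn : m + n < d)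
    (hN : m + n ≤ N) : J m n = 0 :=
  (h.mono (M := m + n) hN).unique isJet_zero (fun i j hij => hF i j (by omega))
    (fun i hi => h0 i (by omega)) (fun i hi => h1 i (by omega)) m n le_rfl

lemma IsJet.add_two_of_eq_zero_of_le (h : IsJet L R F N J) {m n : ℕ} (hN : m + n + 2 ≤ N)
    (hJ : ∀ i j, i + j ≤ m + n → J i j = 0) (hF : ∀ i j, i + j < m + n → F i j = 0) :
    J (m + 2) n =
      - J m (n + 2) - (L 1 0 * J (m + 1) n + L 0 1 * J m (n + 1) + R 0 0 * F m n) := by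
  rw [h m n hN, Finset.sum_eq_single 0, Finset.sum_eq_single 0]
  · simp
  · intro j hj hj0
    have hj' := Finset.mem_range.1 hj
    simp [hJ (m + 1) (n - j) (by omega), hJ m (n - j + 1) (by omega), hF m (n - j) (by omega)]
  · simp
  · intro i hi hi0
    have hi' := Finset.mem_range.1 hi
    refine Finset.sum_eq_zero fun j hj => ?_
    have hj' := Finset.mem_range.1 hj
    simp [hJ (m - i + 1) (n - j) (by omega), hJ (m - i) (n - j + 1) (by omega),
      hF (m - i) (n - j) (by omega)]
  · simp

lemma IsJet.add_two_of_eq_zero_of_lt (h : IsJet L R F N J) {m n : ℕ} (hN : m + n + 2 ≤ N)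
    (hJ : ∀ i j, i + j < m + n + 2 → J i j = 0) (hF : ∀ i j, i + j < m + n → F i j = 0) :
    J (m + 2) n = - J m (n + 2) - R 0 0 * F m n := by
  rw [h.add_two_of_eq_zero_of_le hN (fun i j hij => hJ i j (by omega)) hF,
    hJ (m + 1) n (by omega), hJ m (n + 1) (by omega)]
  ring

lemma IsJet.congr (h : IsJet L R F N J) (hJ : ∀ m n, m + n ≤ N → J m n = J' m n) :
    IsJet L R F N J' := fun m n hmn => by
  rw [← hJ (m + 2) n (by omega), ← hJ m (n + 2) (by omega), h m n hmn]
  congr 1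
  refine Finset.sum_congr rfl fun i hi => Finset.sum_congr rfl fun j hj => ?_
  have hi' := Finset.mem_range.1 hi
  have hj' := Finset.mem_range.1 hj
  rw [hJ (m - i + 1) (n - j) (by omega), hJ (m - i) (n - j + 1) (by omega)]

lemma IsJet.source_eq_zero (hR : R 0 0 ≠ 0) (h : IsJet L R F N J)
    (h' : IsJet L R (fun _ _ => 0) N J) : ∀ m n, m + n + 2 ≤ N → F m n = 0 := by
  have hzero : IsJet L R F N fun _ _ => 0 := by simpa using h.add (h'.const_mul (-1))
  suffices ∀ k m n, m + n = k → k + 2 ≤ N → F m n = 0 from fun m n hmn => this _ m n rfl hmn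
  intro k
  induction k using Nat.strong_induction_on with
  | _ k ih =>
    rintro m n rfl hN
    simpa [hR] using hzero.add_two_of_eq_zero_of_lt hN (fun _ _ _ => rfl)
      fun i j hij => ih _ hij i j rfl (by omega)

-- To lowest order the equation is Laplace's, which trades two `x`-derivatives for two
-- `y`-derivatives and a sign.
lemma IsJet.eq_of_eq_zero_of_lt {d : ℕ} (h : IsJet L R F N J) (hd : d ≤ N)
    (hJ : ∀ m n, m + n < d → J m n = 0) (hF : ∀ m n, m + n + 2 ≤ d → F m n = 0) (m : ℕ) :
    ∀ n, m + n = d → J m n = (-1) ^ (m / 2) * J (m % 2) (d - m % 2) := by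
  induction m using Nat.twoStepInduction with
  | zero => rintro n rfl; simp
  | one => rintro n rfl; simp
  | more m ih _ =>
    intro n hn
    rw [h.add_two_of_eq_zero_of_lt (by omega) (fun i j hij => hJ i j (by omega))
      (fun i j hij => hF i j (by omega)), ih (n + 2) (by omega), hF m n (by omega),
      Nat.add_mod_right, Nat.add_div_right m two_pos, pow_succ]
    ring

lemma formalJet_kron_eq_zero_of_lt {m₀ n₀ m n : ℕ} (hmn : m + n < m₀ + n₀) :
    formalJet L R (kron m₀ n₀) (fun _ _ => 0) m n = 0 :=
  (isJet_formalJet (m + n)).eq_zero_of_lt (fun _ _ _ => rfl)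
    (fun n hn => by
      rw [formalJet_zero, kron, if_neg]; omega)
    (fun n hn => by
      rw [formalJet_one, kron, if_neg]; omega) m n hmn le_rfl

lemma formalJet_kron_of_eq {m₀ n₀ m n : ℕ} (hmn : m + n = m₀ + n₀) :
    formalJet L R (kron m₀ n₀) (fun _ _ => 0) m n = if m % 2 = m₀ then (-1) ^ (m / 2) else 0 := by
  have hJ : formalJet L R (kron m₀ n₀) (fun _ _ => 0) (m % 2) (m₀ + n₀ - m % 2)
      = kron m₀ n₀ (m % 2) (m₀ + n₀ - m % 2) := by
    rcases Nat.mod_two_eq_zero_or_one m with h | h <;> simp only [h, formalJet_zero, formalJet_one]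
  have hiff : (m % 2 = m₀ ∧ m₀ + n₀ - m % 2 = n₀) ↔ m % 2 = m₀ := by omega
  rw [(isJet_formalJet (m₀ + n₀)).eq_of_eq_zero_of_lt le_rfl
    (fun _ _ h => formalJet_kron_eq_zero_of_lt h) (fun _ _ _ => rfl) m n hmn, hJ, kron]
  simp only [hiff, mul_ite, mul_one, mul_zero]

lemma formalJet_source_eq_zero_of_lt {m₀ n₀ m n : ℕ} (hmn : m + n < m₀ + n₀ + 2) :
    formalJet L R (fun _ _ => 0) (kron m₀ n₀) m n = 0 :=
  (isJet_formalJet (m + n)).eq_zero_of_lt (d := m₀ + n₀ + 2)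
    (fun m n hmn => by rw [kron, if_neg]; omega)
    (fun n _ => by rw [formalJet_zero]) (fun n _ => by rw [formalJet_one]) m n hmn le_rfl

lemma formalJet_source_of_eq {m₀ n₀ : ℕ} (m : ℕ) : ∀ n, m + n = m₀ + n₀ + 2 →
    formalJet L R (fun _ _ => 0) (kron m₀ n₀) m n =
      if m₀ + 2 ≤ m ∧ m % 2 = m₀ % 2 then (-1) ^ ((m - m₀) / 2) * R 0 0 else 0 := by
  induction m using Nat.twoStepInduction with
  | zero => intro n _; simp [formalJet_zero]
  | one => intro n _; simp [formalJet_one]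
  | more m ih _ =>
    intro n hn
    rw [(isJet_formalJet (m₀ + n₀ + 2)).add_two_of_eq_zero_of_lt (by omega)
      (fun _ _ h => formalJet_source_eq_zero_of_lt (by omega))
      (fun m n hmn => by rw [kron, if_neg]; omega), ih (n + 2) (by omega),
      Nat.add_mod_right, kron]
    rcases lt_trichotomy m m₀ with h | rfl | h
    · rw [if_neg (by omega), if_neg (by omega), if_neg (by omega)]; simp
    · rw [if_neg (by omega), if_pos (by omega), if_pos (by omega),
        show (m + 2 - m) / 2 = 1 by omega]; simp
    · rw [if_neg (c := m = m₀ ∧ n = n₀) (by omega)]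
      by_cases hp : m % 2 = m₀ % 2
      · rw [if_pos (by omega), if_pos (by omega),
          show (m + 2 - m₀) / 2 = (m - m₀) / 2 + 1 by omega, pow_succ]; ring
      · rw [if_neg (by omega), if_neg (by omega)]; simp

end Jets

/-- The jet of the solution of the homogeneous equation whose Dirichlet data have the jet `δ_n` and
whose normal derivative is given by the homogeneous Robin condition with the coefficient jet `β`. -/
noncomputable def robinJet (L R : ℕ → ℕ → ℝ) (β : ℕ → ℝ) (n : ℕ) : ℕ → ℕ → ℝ :=
  formalJet L R
    (fun m i => if m = 0 then (if i = n then 1 else 0) else (i.choose n : ℝ) * β (i - n))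
    (fun _ _ => 0)

section RobinJet

variable {L R : ℕ → ℕ → ℝ} {β : ℕ → ℝ} {n : ℕ}

lemma isJet_robinJet (N : ℕ) : IsJet L R (fun _ _ => 0) N (robinJet L R β n) := isJet_formalJet N

lemma robinJet_zero (i : ℕ) : robinJet L R β n 0 i = if i = n then 1 else 0 := formalJet_zero i

lemma robinJet_one (i : ℕ) : robinJet L R β n 1 i = (i.choose n : ℝ) * β (i - n) :=
  formalJet_one i

lemma robinJet_eq_zero_of_lt {m j : ℕ} (h : m + j < n) : robinJet L R β n m j = 0 :=
  (isJet_robinJet (m + j)).eq_zero_of_lt (fun _ _ _ => rfl)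
    (fun i hi => by rw [robinJet_zero, if_neg (by omega)])
    (fun i hi => by rw [robinJet_one, Nat.choose_eq_zero_of_lt (by omega)]; simp) m j h le_rfl

lemma robinJet_of_eq {m j : ℕ} (hmj : m + j = n) :
    robinJet L R β n m j = if m % 2 = 0 then (-1) ^ (m / 2) else 0 := by
  rw [(isJet_robinJet n).eq_of_eq_zero_of_lt le_rfl (fun _ _ h => robinJet_eq_zero_of_lt h)
    (fun _ _ _ => rfl) m j hmj]
  rcases Nat.mod_two_eq_zero_or_one m with h | h
  · simp [h, robinJet_zero]
  · rw [h, robinJet_one, Nat.choose_eq_zero_of_lt (by omega)]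
    simp

lemma robinJet_of_eq_add_one (m : ℕ) : ∀ j, m + j = n + 1 →
    robinJet L R β n m j = if m % 2 = 0 then (-1) ^ (m / 2) * ((m / 2 : ℕ) * L 0 1)
      else (-1) ^ (m / 2) * (β 0 - (m / 2 : ℕ) * L 1 0) := by
  induction m using Nat.twoStepInduction with
  | zero => intro j hj; rw [robinJet_zero, if_neg (by omega)]; simp
  | one =>
    intro j hj
    obtain rfl : j = n := by omega
    rw [robinJet_one]; simp
  | more m ih _ =>
    intro j hj
    rw [(isJet_robinJet (n + 1)).add_two_of_eq_zero_of_le (by omega)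
      (fun _ _ h => robinJet_eq_zero_of_lt (by omega)) (fun _ _ _ => rfl), ih (j + 2) (by omega),
      robinJet_of_eq (show m + 1 + j = n by omega),
      robinJet_of_eq (show m + (j + 1) = n by omega), Nat.add_mod_right,
      Nat.add_div_right m two_pos]
    rcases Nat.mod_two_eq_zero_or_one m with h | h
    · rw [if_pos h, if_neg (by omega), if_pos h, if_pos h]
      push_cast; rw [pow_succ]; ring
    · rw [if_neg (by omega), if_pos (by omega), if_neg (by omega), if_neg (by omega),
        show (m + 1) / 2 = m / 2 + 1 by omega]
      push_cast; rw [pow_succ]; ring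

end RobinJet

/-! ### The polynomials of the scheme as Taylor polynomials -/

lemma jetPoly_congr {J J' : ℕ → ℕ → ℝ} {N : ℕ} (h : ∀ m n, m + n ≤ N → J m n = J' m n)
    (x y : ℝ) : jetPoly J N x y = jetPoly J' N x y :=
  Finset.sum_congr rfl fun p hp => by rw [h p.1 p.2 (mem_Lam.1 hp)]

lemma jetPoly_add (J J' : ℕ → ℕ → ℝ) (N : ℕ) (x y : ℝ) :
    jetPoly (fun m n => J m n + J' m n) N x y = jetPoly J N x y + jetPoly J' N x y := by
  simp only [jetPoly, add_mul, Finset.sum_add_distrib]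

lemma jetPoly_sum {ι : Type*} (s : Finset ι) (c : ι → ℝ) (J : ι → ℕ → ℕ → ℝ) (N : ℕ) (x y : ℝ) :
    jetPoly (fun m n => ∑ i ∈ s, c i * J i m n) N x y = ∑ i ∈ s, c i * jetPoly (J i) N x y := by
  simp only [jetPoly, Finset.sum_mul, Finset.mul_sum]
  rw [Finset.sum_comm]
  simp only [mul_assoc]

lemma sum_Lam_mul_kron (F : ℕ → ℕ → ℝ) {m n K : ℕ} (h : m + n ≤ K) :
    ∑ p ∈ Lam K, F p.1 p.2 * kron p.1 p.2 m n = F m n := by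
  rw [Finset.sum_eq_single_of_mem (m, n) (mem_Lam.2 h)]
  · simp [kron]
  · rintro ⟨i, j⟩ _ hij
    have : ¬ (m = i ∧ n = j) := fun e => hij (by simp [e.1, e.2])
    simp [kron, this]

lemma mem_LamV2 {K : ℕ} {p : ℕ × ℕ} : p ∈ LamV2 K ↔ p.1 + p.2 ≤ K ∧ 2 ≤ p.1 := by
  simp only [LamV2, Finset.mem_filter, mem_Lam]

lemma jetPoly_eq_homogPart_add_sum {J : ℕ → ℕ → ℝ} {K N : ℕ} (hKN : K ≤ N)
    (hlt : ∀ m n, m + n < K → J m n = 0) (hgt : ∀ m n, m ≤ 1 → K < m + n → J m n = 0) (x y : ℝ) :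
    jetPoly J N x y = homogPart J K x y
      + ∑ p ∈ LamV2 N \ LamV2 K, J p.1 p.2 * divMonomial p x y := by
  have hdisj : Disjoint (antidiagonal K) (LamV2 N \ LamV2 K) := by
    rw [Finset.disjoint_left]
    simp only [Finset.HasAntidiagonal.mem_antidiagonal, Finset.mem_sdiff, mem_LamV2]
    omega
  rw [homogPart, ← Finset.sum_union hdisj, jetPoly]
  refine (Finset.sum_subset (fun p hp => ?_) fun p _ hp => ?_).symm
  · simp only [Finset.mem_union, Finset.HasAntidiagonal.mem_antidiagonal, Finset.mem_sdiff,
      mem_LamV2] at hp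
    exact mem_Lam.2 (by omega)
  · simp only [Finset.mem_union, Finset.HasAntidiagonal.mem_antidiagonal, Finset.mem_sdiff,
      mem_LamV2] at hp
    have hp' : J p.1 p.2 = 0 := by
      rcases lt_or_ge (p.1 + p.2) K with h | h
      · exact hlt _ _ h
      · exact hgt _ _ (by grind [mem_Lam]) (by omega)
    rw [hp', zero_mul]

namespace SideRect

variable {D : SideRect} {a : ℝ → ℝ → ℝ}

lemma homogPart_AVu {m₀ : ℕ} (hm₀ : m₀ ≤ 1) (n₀ : ℕ) (x y : ℝ) :
    homogPart (fun m n => D.AVu a m n m₀ n₀) (m₀ + n₀) x y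
      = ∑ l ∈ Finset.range (n₀ / 2 + 1), (-1) ^ l * divMonomial (m₀ + 2 * l, n₀ - 2 * l) x y := by
  refine (Finset.sum_of_injOn (fun l => (m₀ + 2 * l, n₀ - 2 * l)) (fun l _ l' _ hl => ?_)
    (fun l hl => ?_) (fun p hp hp' => ?_) (fun l hl => ?_)).symm
  · simp only [Prod.mk.injEq] at hl
    omega
  · have := Finset.mem_range.1 hl
    exact Finset.mem_coe.2 (Finset.HasAntidiagonal.mem_antidiagonal.2 (by simp only; omega))
  · have hp := Finset.HasAntidiagonal.mem_antidiagonal.1 hp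
    simp only [AVu]
    rw [formalJet_kron_of_eq hp, if_neg, zero_mul]
    exact fun hmod => hp' ⟨p.1 / 2, Finset.mem_coe.2 (Finset.mem_range.2 (by omega)),
      Prod.ext (by simp only; omega) (by simp only; omega)⟩
  · have := Finset.mem_range.1 hl
    simp only [AVu]
    rw [formalJet_kron_of_eq (by omega), if_pos (by omega),
      show (m₀ + 2 * l) / 2 = l by omega]

lemma homogPart_AVf (m₀ n₀ : ℕ) (x y : ℝ) :
    homogPart (fun m n => D.AVf a m n m₀ n₀) (m₀ + n₀ + 2) x y
      = ∑ l ∈ Finset.Icc 1 (1 + n₀ / 2),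
          (-1) ^ l * (a D.l₁ D.y₀)⁻¹ * divMonomial (m₀ + 2 * l, n₀ + 2 - 2 * l) x y := by
  refine (Finset.sum_of_injOn (fun l => (m₀ + 2 * l, n₀ + 2 - 2 * l)) (fun l _ l' _ hl => ?_)
    (fun l hl => ?_) (fun p hp hp' => ?_) (fun l hl => ?_)).symm
  · simp only [Prod.mk.injEq] at hl
    omega
  · have := Finset.mem_Icc.1 hl
    exact Finset.mem_coe.2 (Finset.HasAntidiagonal.mem_antidiagonal.2 (by simp only; omega))
  · have hp := Finset.HasAntidiagonal.mem_antidiagonal.1 hp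
    simp only [AVf]
    rw [formalJet_source_of_eq _ _ hp, if_neg, zero_mul]
    exact fun hmod => hp' ⟨(p.1 - m₀) / 2, Finset.mem_coe.2 (Finset.mem_Icc.2 (by omega)),
      Prod.ext (by simp only; omega) (by simp only; omega)⟩
  · have := Finset.mem_Icc.1 hl
    simp only [AVf]
    rw [formalJet_source_of_eq _ _ (by omega), if_pos (by omega),
      show (m₀ + 2 * l - m₀) / 2 = l by omega, pd_zero_zero]

lemma jetPoly_AVu {m₀ n₀ M : ℕ} (hm₀ : m₀ ≤ 1) (h : m₀ + n₀ ≤ M + 1) (x y : ℝ) :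
    jetPoly (fun m n => D.AVu a m n m₀ n₀) (M + 1) x y = D.GV a M m₀ n₀ x y := by
  have hgt : ∀ m n, m ≤ 1 → m₀ + n₀ < m + n → D.AVu a m n m₀ n₀ = 0 := fun m n hm hmn => by
    obtain rfl | rfl : m = 0 ∨ m = 1 := by omega
    · rw [AVu, formalJet_zero, kron, if_neg (by omega)]
    · rw [AVu, formalJet_one, kron, if_neg (by omega)]
  rw [jetPoly_eq_homogPart_add_sum (J := fun m n => D.AVu a m n m₀ n₀) h
    (fun _ _ => formalJet_kron_eq_zero_of_lt) hgt,
    homogPart_AVu hm₀]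
  simp only [GV, divMonomial, mul_div_assoc, mul_assoc]

lemma jetPoly_AVf {m₀ n₀ M : ℕ} (h : m₀ + n₀ + 2 ≤ M + 1) (x y : ℝ) :
    jetPoly (fun m n => D.AVf a m n m₀ n₀) (M + 1) x y = D.QV a M m₀ n₀ x y := by
  have hgt : ∀ m n, m ≤ 1 → m₀ + n₀ + 2 < m + n → D.AVf a m n m₀ n₀ = 0 := fun m n hm _ => by
    obtain rfl | rfl : m = 0 ∨ m = 1 := by omega
    · rw [AVf, formalJet_zero]
    · rw [AVf, formalJet_one]
  rw [jetPoly_eq_homogPart_add_sum (J := fun m n => D.AVf a m n m₀ n₀) h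
    (fun _ _ => formalJet_source_eq_zero_of_lt) hgt,
    homogPart_AVf]
  simp only [QV, divMonomial, one_div]
  congr 1
  exact Finset.sum_congr rfl fun l _ => by ring

/-- The jet of the solution of the homogeneous boundary value problem with the Dirichlet data
`(y - y₀) ^ n / n!`; its Taylor polynomials are the polynomials in the linear system for the
coefficients of the scheme. -/
noncomputable def boundaryJet (D : SideRect) (a : ℝ → ℝ → ℝ) (α : ℝ → ℝ) (n : ℕ) : ℕ → ℕ → ℝ :=
  robinJet (D.pd fun x y => Real.log (a x y)) (D.pd fun x y => (a x y)⁻¹) (D.bd α) n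

lemma jetPoly_boundaryJet {M n : ℕ} (α : ℝ → ℝ) (hn : n ≤ M + 1) (x y : ℝ) :
    jetPoly (D.boundaryJet a α n) (M + 1) x y = D.GV a M 0 n x y
        + ∑ i ∈ Finset.Icc n M, (i.choose n : ℝ) * D.bd α (i - n) * D.GV a M 1 i x y := by
  have h1 : ∀ i ∈ Finset.Icc n M, (i.choose n : ℝ) * D.bd α (i - n) * D.GV a M 1 i x y =
      (i.choose n : ℝ) * D.bd α (i - n) * jetPoly (fun m n => D.AVu a m n 1 i) (M + 1) x y :=
    fun i hi => by rw [jetPoly_AVu le_rfl (by grind)]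
  rw [← jetPoly_AVu zero_le_one (by omega), Finset.sum_congr rfl h1, ← jetPoly_sum, ← jetPoly_add]
  refine jetPoly_congr ((isJet_robinJet (M + 1)).unique ((isJet_formalJet _).add
    (IsJet.sum _ _ fun i _ => isJet_formalJet _)) (fun _ _ _ => by simp) (fun i _ => ?_)
    (fun i hi => ?_)) x y
  · simp [robinJet_zero, formalJet_zero, kron]
  · simp only [robinJet_one, formalJet_one, kron]
    by_cases hin : n ≤ i
    · rw [Finset.sum_eq_single_of_mem i (Finset.mem_Icc.2 ⟨hin, by omega⟩) (by grind)]
      simp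
    · rw [Nat.choose_eq_zero_of_lt (by omega), Finset.sum_eq_zero (by grind)]
      simp

end SideRect

namespace SideRect

variable {D : SideRect} {a u f : ℝ → ℝ → ℝ} {α g : ℝ → ℝ}

lemma IsExactSolution.of_le {r r' : ℕ∞} (h : D.IsExactSolution a α r u f g) (hr : r' ≤ r) :
    D.IsExactSolution a α r' u f g :=
  ⟨h.smooth_u.of_le (add_le_add_left hr 2), h.smooth_f.of_le hr,
    ContDiffOn.of_le h.smooth_g (by exact_mod_cast hr), h.pde, h.bc⟩

lemma IsExactSolution.eqBar {r : ℕ∞} (ha : D.SmoothOn 1 a) (h : D.IsExactSolution a α r u f g) :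
    D.EqBar (D.negDivGrad a u) f :=
  negDivGrad_eqBar ha (h.smooth_u.of_le le_add_self) (h.smooth_f.of_le bot_le) h.pde

lemma isJet_pd {N : ℕ} (ha₀ : ∀ z ∈ D.OmegaBar, a z.1 z.2 ≠ 0) (ha : D.SmoothOn (N + 1 : ℕ) a)
    (hu : D.SmoothOn (N + 2 : ℕ) u) (hf : D.SmoothOn N f) (h : D.EqBar (D.negDivGrad a u) f) :
    IsJet (D.pd fun x y => Real.log (a x y)) (D.pd fun x y => (a x y)⁻¹) (D.pd f) (N + 2)
      (D.pd u) := fun m n hmn =>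
  pd_add_two ha₀ (ha.of_le (by exact_mod_cast (by omega))) (hu.of_le (by exact_mod_cast hmn))
    (hf.of_le (by exact_mod_cast (by omega))) h

lemma IsExactSolution.pd_one {N n : ℕ} (hα : D.SmoothSide N α)
    (h : D.IsExactSolution a α N u f g) (hn : n ≤ N) :
    D.pd u 1 n =
      ∑ i ∈ Finset.range (N + 2), D.pd u 0 i * ((n.choose i : ℝ) * D.bd α (n - i)) - D.bd g n := by
  have hα' : D.SmoothSide n α := ContDiffOn.of_le hα (by exact_mod_cast hn)
  have hu : D.SmoothOn (n + 1 : ℕ) u := h.smooth_u.of_le (by exact_mod_cast (by omega))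
  rw [bd_robin hα' hu h.bc,
    Finset.sum_subset (Finset.range_subset_range.2 (show n + 1 ≤ N + 2 by omega))]
  · simp only [mul_comm (D.pd u 0 _)]; ring
  · intro i _ hi
    rw [Nat.choose_eq_zero_of_lt (by simpa using hi)]; simp

lemma jetPoly_pd {M : ℕ} (ha₀ : ∀ z ∈ D.OmegaBar, a z.1 z.2 ≠ 0) (ha : D.SmoothOn (M + 1 : ℕ) a)
    (hα : D.SmoothSide (M + 1 : ℕ) α) (h : D.IsExactSolution a α (M + 1 : ℕ) u f g) (x y : ℝ) :
    jetPoly (D.pd u) (M + 2) x y =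
      ∑ n ∈ Finset.range (M + 3), D.pd u 0 n * jetPoly (D.boundaryJet a α n) (M + 2) x y
        + (∑ n ∈ Finset.range (M + 2), (- D.bd g n) * D.GV a (M + 1) 1 n x y
          + ∑ p ∈ Lam M, D.pd f p.1 p.2 * D.QV a (M + 1) p.1 p.2 x y) := by
  have hG : ∀ n ∈ Finset.range (M + 2), (- D.bd g n) * D.GV a (M + 1) 1 n x y =
      (- D.bd g n) * jetPoly (fun i j => D.AVu a i j 1 n) (M + 2) x y := fun n hn => by
    rw [jetPoly_AVu le_rfl (by grind)]
  have hQ : ∀ p ∈ Lam M, D.pd f p.1 p.2 * D.QV a (M + 1) p.1 p.2 x y =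
      D.pd f p.1 p.2 * jetPoly (fun i j => D.AVf a i j p.1 p.2) (M + 2) x y := fun p hp => by
    rw [jetPoly_AVf (by grind [mem_Lam])]
  have hu : IsJet (D.pd fun x y => Real.log (a x y)) (D.pd fun x y => (a x y)⁻¹) (D.pd f) (M + 2)
      (D.pd u) := isJet_pd ha₀ ha (h.smooth_u.of_le (by exact_mod_cast (by omega)))
    (h.smooth_f.of_le (by exact_mod_cast (by omega)))
    (h.eqBar (ha.of_le (by exact_mod_cast (by omega))))
  rw [Finset.sum_congr rfl hG, Finset.sum_congr rfl hQ, ← jetPoly_sum, ← jetPoly_sum,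
    ← jetPoly_sum, ← jetPoly_add, ← jetPoly_add]
  refine jetPoly_congr (hu.unique ((IsJet.sum _ _ fun i _ => isJet_robinJet _).add
    ((IsJet.sum _ _ fun i _ => isJet_formalJet _).add (IsJet.sum _ _ fun i _ => isJet_formalJet _)))
    (fun m n hmn => ?_) (fun n hn => ?_) (fun n hn => ?_)) x y
  · rw [sum_Lam_mul_kron _ (by omega)]
    simp
  · have : n < M + 3 := by omega
    simp [robinJet_zero, formalJet_zero, kron, this]
  · have : n < M + 2 := by omega
    rw [h.pd_one hα (by omega), sub_eq_add_neg]
    simp [robinJet_one, formalJet_one, kron, this]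

/-! ### Schemes of order six -/

lemma continuous_polyC (c : ℤ × ℤ → ℕ → ℝ) (s : ℤ × ℤ) : Continuous (polyC c s) := by
  unfold polyC; fun_prop

lemma polyC_isBigO_one (c : ℤ × ℤ → ℕ → ℝ) (s : ℤ × ℤ) :
    polyC c s =O[𝓝[>] 0] fun _ => (1 : ℝ) :=
  ((continuous_polyC c s).tendsto 0).isBigO_one ℝ |>.mono nhdsWithin_le_nhds

lemma tendsto_polyC (c : ℤ × ℤ → ℕ → ℝ) (s : ℤ × ℤ) :
    Tendsto (polyC c s) (𝓝[>] 0) (𝓝 (c s 0)) :=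
  ((continuous_polyC c s).tendsto' 0 (c s 0) (by simp [polyC, Finset.sum_range_succ])).mono_left
    nhdsWithin_le_nhds

lemma zero_le_of_mem_stencil {s : ℤ × ℤ} (hs : s ∈ stencil) : (0 : ℝ) ≤ s.1 := by
  have : s.1 ∈ ({0, 1} : Finset ℤ) := (Finset.mem_product.1 hs).1
  exact_mod_cast show 0 ≤ s.1 by grind

lemma solvesSystem_iff {c : ℤ × ℤ → ℕ → ℝ} : D.SolvesSystem a α c ↔ ∀ n ≤ 6,
    (fun h : ℝ => ∑ s ∈ stencil,
      polyC c s h * jetPoly (D.boundaryJet a α n) 6 (s.1 * h) (s.2 * h))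
      =O[𝓝[>] 0] fun h : ℝ => h ^ 7 := by
  unfold SolvesSystem
  refine forall_congr' fun n => ?_
  rw [Finset.mem_range, Nat.lt_succ_iff]
  refine forall_congr' fun hn => ?_
  simp only [jetPoly_boundaryJet α hn]

lemma inv_mul_isBigO {F : ℝ → ℝ} {p : ℕ} (hF : F =O[𝓝[>] 0] fun h : ℝ => h ^ (p + 1)) :
    (fun h : ℝ => h⁻¹ * F h) =O[𝓝[>] 0] fun h : ℝ => h ^ p := by
  refine ((isBigO_refl (fun h : ℝ => h⁻¹) (𝓝[>] 0)).mul hF).congr' EventuallyEq.rfl ?_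
  filter_upwards [self_mem_nhdsWithin] with h hh
  rw [pow_succ', inv_mul_cancel_left₀ (ne_of_gt hh)]

lemma SolvesSystem.hasTruncationOrder {c : ℤ × ℤ → ℕ → ℝ}
    (ha₀ : ∀ z ∈ D.OmegaBar, a z.1 z.2 ≠ 0) (ha : D.SmoothOn 5 a)
    (hα : D.SmoothSide 5 α) (hc : D.SolvesSystem a α c) :
    (D.robinScheme a c).HasTruncationOrder D a α 5 6 := by
  intro u f g h
  refine inv_mul_isBigO ?_
  rw [solvesSystem_iff] at hc
  have hu : D.SmoothOn (6 + 1 : ℕ) u := h.smooth_u.of_le (by exact_mod_cast (by norm_num))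
  have htaylor : (fun h : ℝ => ∑ s ∈ stencil, polyC c s h * (u (D.l₁ + s.1 * h) (D.y₀ + s.2 * h)
      - jetPoly (D.pd u) 6 (s.1 * h) (s.2 * h))) =O[𝓝[>] 0] fun h : ℝ => h ^ 7 :=
    IsBigO.fun_sum fun s hs => by
      simpa using (polyC_isBigO_one c s).mul (taylor_ray hu (zero_le_of_mem_stencil hs) s.2)
  have hsys : (fun h : ℝ => ∑ n ∈ Finset.range 7, D.pd u 0 n * ∑ s ∈ stencil,
      polyC c s h * jetPoly (D.boundaryJet a α n) 6 (s.1 * h) (s.2 * h))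
      =O[𝓝[>] 0] fun h : ℝ => h ^ 7 :=
    IsBigO.fun_sum fun n hn => (hc n (Nat.lt_succ_iff.1 (Finset.mem_range.1 hn))).const_mul_left _
  refine (htaylor.add hsys).congr_left fun t => ?_
  simp only [SixPointScheme.lhs, SixPointScheme.rhs, robinScheme,
    jetPoly_pd (M := 4) ha₀ ha hα h,
    Finset.mul_sum, mul_sub, mul_add, Finset.sum_sub_distrib, Finset.sum_add_distrib, mul_neg,
    neg_mul, Finset.sum_neg_distrib]
  rw [Finset.sum_comm (s := stencil) (t := Finset.range 7),
    Finset.sum_comm (s := stencil) (t := Finset.range 6),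
    Finset.sum_comm (s := stencil) (t := Lam 4)]
  simp only [mul_left_comm (polyC c _ t)]
  ring

end SideRect

/-! ### Moments of weights on the stencil -/

lemma sum_stencil {M : Type*} [AddCommMonoid M] (F : ℤ × ℤ → M) :
    ∑ s ∈ stencil, F s =
      F (0, -1) + (F (0, 0) + F (0, 1)) + (F (1, -1) + (F (1, 0) + F (1, 1))) := by
  simp [stencil, Finset.sum_product]

lemma forall_stencil {p : ℤ × ℤ → Prop} : (∀ s ∈ stencil, p s) ↔
    p (0, -1) ∧ p (0, 0) ∧ p (0, 1) ∧ p (1, -1) ∧ p (1, 0) ∧ p (1, 1) := by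
  have : stencil = {(0, -1), (0, 0), (0, 1), (1, -1), (1, 0), (1, 1)} := rfl
  simp only [this, Finset.forall_mem_insert, Finset.mem_singleton, forall_eq]

/-- The degree `d` part of a Taylor polynomial, summed over the stencil with the weights `v`. -/
noncomputable def moment (J : ℕ → ℕ → ℝ) (d : ℕ) (v : ℤ × ℤ → ℝ) : ℝ :=
  ∑ s ∈ stencil, v s * homogPart J d s.1 s.2

/-- The weights `(2, -10, 2)` on the side and `(1, 4, 1)` next to it, which span the kernel of the
leading order system. -/
def leadWeight (s : ℤ × ℤ) : ℝ :=
  if s.1 = 0 then (if s.2 = 0 then -10 else 2) else (if s.2 = 0 then 4 else 1)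

/-- The matrix of the right inverse `correctionWeight` of the leading order system. -/
noncomputable def correctionCoeff (s : ℤ × ℤ) : Fin 5 → ℝ :=
  if s = (1, 1) then ![0, 1 / 3, 0, -2, 0]
  else if s = (1, 0) then ![0, 2 / 3, -1, -4, 12]
  else if s = (0, -1) then ![0, 0, 1 / 2, -3, 6]
  else if s = (0, 1) then ![0, 2 / 3, 1 / 2, -1, 6]
  else if s = (0, 0) then ![1, -5 / 3, 0, 10, -24]
  else 0

/-- The weights vanishing at `(1, -1)` whose leading moments of the degrees `0, …, 4` are
`ρ 0, …, ρ 4`. -/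
noncomputable def correctionWeight (ρ : ℕ → ℝ) (s : ℤ × ℤ) : ℝ :=
  ∑ n : Fin 5, correctionCoeff s n * ρ n

section Moment

variable {L R : ℕ → ℕ → ℝ} {β : ℕ → ℝ}

lemma homogPart_robinJet_of_lt {n d : ℕ} (h : d < n) (x y : ℝ) :
    homogPart (robinJet L R β n) d x y = 0 :=
  Finset.sum_eq_zero fun p hp => by
    rw [robinJet_eq_zero_of_lt (by rw [Finset.HasAntidiagonal.mem_antidiagonal.1 hp]; exact h),
      zero_mul]

lemma homogPart_robinJet_self (n : ℕ) (x y : ℝ) :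
    homogPart (robinJet L R β n) n x y = ∑ p ∈ antidiagonal n,
      (if p.1 % 2 = 0 then (-1) ^ (p.1 / 2) else 0) * divMonomial p x y :=
  Finset.sum_congr rfl fun p hp => by
    rw [robinJet_of_eq (Finset.HasAntidiagonal.mem_antidiagonal.1 hp)]

lemma homogPart_robinJet_add_one (n : ℕ) (x y : ℝ) :
    homogPart (robinJet L R β n) (n + 1) x y =
      ∑ p ∈ antidiagonal (n + 1),
        (if p.1 % 2 = 0 then (-1) ^ (p.1 / 2) * ((p.1 / 2 : ℕ) * L 0 1)
          else (-1) ^ (p.1 / 2) * (β 0 - (p.1 / 2 : ℕ) * L 1 0)) * divMonomial p x y :=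
  Finset.sum_congr rfl fun p hp => by
    rw [robinJet_of_eq_add_one _ _ (Finset.HasAntidiagonal.mem_antidiagonal.1 hp)]

lemma moment_robinJet_of_lt {n d : ℕ} (h : d < n) (v : ℤ × ℤ → ℝ) :
    moment (robinJet L R β n) d v = 0 :=
  Finset.sum_eq_zero fun s _ => by rw [homogPart_robinJet_of_lt h, mul_zero]

lemma moment_robinJet_zero (v : ℤ × ℤ → ℝ) : moment (robinJet L R β 0) 0 v =
    v (0, -1) + v (0, 0) + v (0, 1) + v (1, -1) + v (1, 0) + v (1, 1) := by
  simp [moment, sum_stencil, homogPart_robinJet_self, divMonomial]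
  ring

lemma moment_robinJet_one (v : ℤ × ℤ → ℝ) : moment (robinJet L R β 1) 1 v =
    v (0, 1) - v (0, -1) + (v (1, 1) - v (1, -1)) := by
  simp [moment, sum_stencil, homogPart_robinJet_self, divMonomial, Finset.Nat.antidiagonal_succ]
  ring

lemma moment_robinJet_two (v : ℤ × ℤ → ℝ) : moment (robinJet L R β 2) 2 v =
    (v (0, 1) + v (0, -1) - v (1, 0)) / 2 := by
  simp [moment, sum_stencil, homogPart_robinJet_self, divMonomial, Finset.Nat.antidiagonal_succ]
  ring

lemma moment_robinJet_three (v : ℤ × ℤ → ℝ) : moment (robinJet L R β 3) 3 v =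
    (v (0, 1) - v (0, -1) - 2 * (v (1, 1) - v (1, -1))) / 6 := by
  simp [moment, sum_stencil, homogPart_robinJet_self, divMonomial, Finset.Nat.antidiagonal_succ,
    Nat.factorial]
  ring

lemma moment_robinJet_four (v : ℤ × ℤ → ℝ) : moment (robinJet L R β 4) 4 v =
    (v (0, 1) + v (0, -1) + v (1, 0) - 4 * (v (1, 1) + v (1, -1))) / 24 := by
  simp [moment, sum_stencil, homogPart_robinJet_self, divMonomial, Finset.Nat.antidiagonal_succ,
    Nat.factorial]
  ring

lemma moment_robinJet_five (v : ℤ × ℤ → ℝ) :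
    180 * moment (robinJet L R β 5) 5 v =
      15 * moment (robinJet L R β 3) 3 v - moment (robinJet L R β 1) 1 v := by
  simp [moment, sum_stencil, homogPart_robinJet_self, divMonomial, Finset.Nat.antidiagonal_succ,
    Nat.factorial]
  ring

lemma moment_robinJet_six (v : ℤ × ℤ → ℝ) :
    360 * moment (robinJet L R β 6) 6 v = moment (robinJet L R β 2) 2 v := by
  simp [moment, sum_stencil, homogPart_robinJet_self, divMonomial, Finset.Nat.antidiagonal_succ,
    Nat.factorial]
  ring

lemma moment_robinJet_zero_add_one (v : ℤ × ℤ → ℝ) : moment (robinJet L R β 0) 1 v =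
    β 0 * (v (1, -1) + v (1, 0) + v (1, 1)) := by
  rw [moment, Finset.sum_congr rfl fun s _ => by rw [homogPart_robinJet_add_one 0]]
  simp [sum_stencil, divMonomial, Finset.Nat.antidiagonal_succ]
  ring

lemma moment_robinJet_one_add_one_leadWeight :
    moment (robinJet L R β 1) 2 leadWeight = -3 * L 0 1 := by
  rw [moment, Finset.sum_congr rfl fun s _ => by rw [homogPart_robinJet_add_one 1]]
  simp [sum_stencil, divMonomial, Finset.Nat.antidiagonal_succ, leadWeight]
  ring

lemma moment_robinJet_three_add_one_leadWeight :
    moment (robinJet L R β 3) 4 leadWeight = 0 := by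
  rw [moment, Finset.sum_congr rfl fun s _ => by rw [homogPart_robinJet_add_one 3]]
  simp [sum_stencil, divMonomial, Finset.Nat.antidiagonal_succ, leadWeight, Nat.factorial]
  ring

lemma moment_robinJet_five_add_one_leadWeight :
    moment (robinJet L R β 5) 6 leadWeight = L 0 1 / 60 := by
  rw [moment, Finset.sum_congr rfl fun s _ => by rw [homogPart_robinJet_add_one 5]]
  simp [sum_stencil, divMonomial, Finset.Nat.antidiagonal_succ, leadWeight, Nat.factorial]
  ring

-- The relation `moment_robinJet_six` between the leading moments fails at the next order.
lemma moment_robinJet_six_add_one_leadWeight :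
    360 * moment (robinJet L R β 6) 7 leadWeight - moment (robinJet L R β 2) 3 leadWeight
      = -(5 / 7) * (2 * β 0 + L 1 0) := by
  have h6 := fun x y => homogPart_robinJet_add_one (L := L) (R := R) (β := β) 6 x y
  have h2 := fun x y => homogPart_robinJet_add_one (L := L) (R := R) (β := β) 2 x y
  norm_num only at h6 h2
  simp [moment, h6, h2, sum_stencil, divMonomial, Finset.Nat.antidiagonal_succ, leadWeight,
    Nat.factorial]
  ring

lemma moment_correctionWeight (ρ : ℕ → ℝ) {n : ℕ} (hn : n ≤ 4) :
    moment (robinJet L R β n) n (correctionWeight ρ) = ρ n := by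
  interval_cases n <;>
    simp [correctionWeight, correctionCoeff, Fin.sum_univ_five, moment_robinJet_zero,
      moment_robinJet_one, moment_robinJet_two, moment_robinJet_three, moment_robinJet_four] <;>
    ring

lemma eq_leadWeight_add_correctionWeight (v : ℤ × ℤ → ℝ) : ∀ s ∈ stencil,
    v s = v (1, -1) * leadWeight s
      + correctionWeight (fun n => moment (robinJet L R β n) n v) s := by
  rw [forall_stencil]
  refine ⟨?_, ?_, ?_, ?_, ?_, ?_⟩ <;>
    simp [correctionWeight, correctionCoeff, Fin.sum_univ_five, moment_robinJet_zero,
      moment_robinJet_one, moment_robinJet_two, moment_robinJet_three, moment_robinJet_four,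
      leadWeight] <;>
    ring

lemma moment_robinJet_self_leadWeight {n : ℕ} (hn : n ≤ 6) :
    moment (robinJet L R β n) n leadWeight = 0 := by
  have h1 : moment (robinJet L R β 1) 1 leadWeight = 0 := by
    rw [moment_robinJet_one]; norm_num [leadWeight]
  have h2 : moment (robinJet L R β 2) 2 leadWeight = 0 := by
    rw [moment_robinJet_two]; norm_num [leadWeight]
  have h3 : moment (robinJet L R β 3) 3 leadWeight = 0 := by
    rw [moment_robinJet_three]; norm_num [leadWeight]
  have h5 := moment_robinJet_five (L := L) (R := R) (β := β) leadWeight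
  have h6 := moment_robinJet_six (L := L) (R := R) (β := β) leadWeight
  interval_cases n
  · rw [moment_robinJet_zero]; norm_num [leadWeight]
  · exact h1
  · exact h2
  · exact h3
  · rw [moment_robinJet_four]; norm_num [leadWeight]
  · linarith
  · linarith

end Moment

/-- The coefficients of `h ^ j` in the weights of a scheme of order six, found order by order: the
`j`-th correction cancels the contributions of the earlier ones to the leading moments. -/
noncomputable def schemeWeight (L R : ℕ → ℕ → ℝ) (β : ℕ → ℝ) : ℕ → ℤ × ℤ → ℝ
  | 0 => leadWeight
  | j + 1 => correctionWeight fun n =>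
      - ∑ i : Fin (j + 1), moment (robinJet L R β n) (n + (j + 1) - i) (schemeWeight L R β i)

section SchemeWeight

variable {L R : ℕ → ℕ → ℝ} {β : ℕ → ℝ}

lemma moment_schemeWeight_add_one {n : ℕ} (j : ℕ) (hn : n ≤ 4) :
    moment (robinJet L R β n) n (schemeWeight L R β (j + 1)) =
      - ∑ i ∈ Finset.range (j + 1),
        moment (robinJet L R β n) (n + (j + 1) - i) (schemeWeight L R β i) := by
  rw [schemeWeight, moment_correctionWeight _ hn, Finset.sum_range]

-- `moment_robinJet_five` makes this a compatibility condition on the first corrections.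
lemma moment_schemeWeight_one :
    moment (robinJet L R β 5) 5 (schemeWeight L R β 1) =
      - moment (robinJet L R β 5) 6 leadWeight := by
  have h5 := moment_robinJet_five (L := L) (R := R) (β := β) (schemeWeight L R β 1)
  have h1 := moment_schemeWeight_add_one (L := L) (R := R) (β := β) (n := 1) 0 (by norm_num)
  have h3 := moment_schemeWeight_add_one (L := L) (R := R) (β := β) (n := 3) 0 (by norm_num)
  simp only [zero_add, Finset.sum_range_one, Nat.sub_zero, Nat.reduceAdd, schemeWeight.eq_1,
    moment_robinJet_one_add_one_leadWeight, moment_robinJet_three_add_one_leadWeight] at h1 h3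
  rw [h1, h3] at h5
  rw [moment_robinJet_five_add_one_leadWeight]
  linarith

lemma sum_moment_schemeWeight {n j : ℕ} (h : n + j ≤ 6) :
    ∑ i ∈ Finset.range (j + 1),
      moment (robinJet L R β n) (n + j - i) (schemeWeight L R β i) = 0 := by
  obtain _ | j := j
  · simpa [schemeWeight] using moment_robinJet_self_leadWeight h
  rw [Finset.sum_range_succ, Nat.add_sub_cancel]
  by_cases hn : n ≤ 4
  · rw [moment_schemeWeight_add_one j hn, add_neg_cancel]
  · obtain ⟨rfl, rfl⟩ : n = 5 ∧ j = 0 := by omega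
    simp [schemeWeight.eq_1, moment_schemeWeight_one]

lemma sum_antidiagonal_moment_schemeWeight {n k : ℕ} (hk : k ≤ 6) :
    ∑ p ∈ antidiagonal k,
      moment (robinJet L R β n) p.2 (schemeWeight L R β p.1) = 0 := by
  rw [Finset.Nat.sum_antidiagonal_eq_sum_range_succ
    (fun i d => moment (robinJet L R β n) d (schemeWeight L R β i))]
  rcases Nat.lt_or_ge k n with hkn | hkn
  · exact Finset.sum_eq_zero fun i _ => moment_robinJet_of_lt (by omega) _
  · obtain ⟨j, rfl⟩ := Nat.exists_eq_add_of_le hkn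
    rw [← sum_moment_schemeWeight hk]
    refine (Finset.sum_subset (Finset.range_subset_range.2 (by omega)) fun i hi hi' => ?_).symm
    rw [Finset.mem_range] at hi hi'
    exact moment_robinJet_of_lt (by omega) _

end SchemeWeight

lemma sum_mul_jetPoly (J : ℕ → ℕ → ℝ) (N : ℕ) (C : ℤ × ℤ → ℝ) (h : ℝ) :
    ∑ s ∈ stencil, C s * jetPoly J N (s.1 * h) (s.2 * h)
      = ∑ d ∈ Finset.range (N + 1), h ^ d * moment J d C := by
  simp only [jetPoly_eq_sum, homogPart_mul, moment, Finset.mul_sum]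
  rw [Finset.sum_comm]
  simp only [mul_left_comm]

lemma isBigO_pow_of_le {p q : ℕ} (hpq : p ≤ q) :
    (fun h : ℝ => h ^ q) =O[𝓝[>] 0] fun h : ℝ => h ^ p := by
  rcases hpq.eq_or_lt with rfl | hlt
  · exact isBigO_refl _ _
  · exact (isLittleO_pow_pow hlt).isBigO.mono nhdsWithin_le_nhds

lemma isBigO_of_sum_antidiagonal_eq_zero {N : ℕ} {X : ℕ → ℕ → ℝ}
    (hX : ∀ k < N, ∑ p ∈ antidiagonal k, X p.1 p.2 = 0) :
    (fun h : ℝ => ∑ p ∈ Finset.range N ×ˢ Finset.range N, h ^ (p.1 + p.2) * X p.1 p.2)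
      =O[𝓝[>] 0] fun h : ℝ => h ^ N := by
  have hlow : ∀ h : ℝ, ∑ p ∈ Finset.range N ×ˢ Finset.range N with p.1 + p.2 < N,
      h ^ (p.1 + p.2) * X p.1 p.2 = 0 := fun h => by
    rw [← Finset.sum_fiberwise_of_maps_to (t := Finset.range N) (g := fun p : ℕ × ℕ => p.1 + p.2)
      (by simp)]
    refine Finset.sum_eq_zero fun k hk => ?_
    have hfiber : {p ∈ {p ∈ Finset.range N ×ˢ Finset.range N | p.1 + p.2 < N} | p.1 + p.2 = k}
        = antidiagonal k := by
      ext p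
      grind [Finset.HasAntidiagonal.mem_antidiagonal]
    rw [hfiber, ← mul_zero (h ^ k), ← hX k (Finset.mem_range.1 hk), Finset.mul_sum]
    exact Finset.sum_congr rfl fun p hp => by rw [Finset.HasAntidiagonal.mem_antidiagonal.1 hp]
  simp only [← Finset.sum_filter_add_sum_filter_not (Finset.range N ×ˢ Finset.range N)
    (fun p => p.1 + p.2 < N), hlow, zero_add]
  refine IsBigO.fun_sum fun p hp => ?_
  simpa only [mul_comm] using
    (isBigO_pow_of_le (not_lt.1 (Finset.mem_filter.1 hp).2)).const_mul_left (X p.1 p.2)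

namespace SideRect

lemma exists_solvesSystem (D : SideRect) (a : ℝ → ℝ → ℝ) (α : ℝ → ℝ) :
    ∃ c : ℤ × ℤ → ℕ → ℝ, D.SolvesSystem a α c ∧ ∃ s ∈ stencil, c s 0 ≠ 0 := by
  set w := schemeWeight (D.pd fun x y => Real.log (a x y)) (D.pd fun x y => (a x y)⁻¹) (D.bd α)
  refine ⟨fun s i => w i s, ?_, (1, 0), by decide, by simp [w, schemeWeight, leadWeight]⟩
  rw [solvesSystem_iff]
  intro n _
  refine (isBigO_of_sum_antidiagonal_eq_zero (N := 7)
    (X := fun i d => moment (D.boundaryJet a α n) d (w i))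
    fun k hk => sum_antidiagonal_moment_schemeWeight (by omega)).congr_left fun h => ?_
  rw [sum_mul_jetPoly (C := fun s => polyC (fun s i => w i s) s h), Finset.sum_product_right]
  refine Finset.sum_congr rfl fun k _ => ?_
  simp only [moment, polyC, Finset.mul_sum, Finset.sum_mul]
  rw [Finset.sum_comm]
  refine Finset.sum_congr rfl fun s _ => Finset.sum_congr rfl fun i _ => ?_
  rw [pow_add]
  ring

end SideRect

lemma isBigO_of_pow_mul {F G : ℝ → ℝ} {n : ℕ}
    (h : (fun t : ℝ => t ^ n * F t) =O[𝓝[>] 0] fun t : ℝ => t ^ n * G t) : F =O[𝓝[>] 0] G := by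
  have hcancel : ∀ H : ℝ → ℝ, (fun t : ℝ => (t ^ n)⁻¹ * (t ^ n * H t)) =ᶠ[𝓝[>] 0] H := fun H => by
    filter_upwards [self_mem_nhdsWithin] with t ht
    exact inv_mul_cancel_left₀ (pow_ne_zero n (ne_of_gt ht)) _
  exact ((isBigO_refl (fun t : ℝ => (t ^ n)⁻¹) (𝓝[>] 0)).mul h).congr' (hcancel F) (hcancel G)

lemma moment_isBigO {l : Filter ℝ} {C : ℤ × ℤ → ℝ → ℝ} {M : ℝ → ℝ} (J : ℕ → ℕ → ℝ) (d : ℕ)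
    (hC : ∀ s ∈ stencil, C s =O[l] M) : (fun h => moment J d fun s => C s h) =O[l] M :=
  IsBigO.fun_sum fun s hs => by
    simpa only [mul_comm] using (hC s hs).const_mul_left (homogPart J d s.1 s.2)

lemma moment_robinJet_expansion {L R : ℕ → ℕ → ℝ} {β : ℕ → ℝ} {n N : ℕ} (hN : n + 2 ≤ N)
    {C : ℤ × ℤ → ℝ → ℝ} {M : ℝ → ℝ} (hC : ∀ s ∈ stencil, C s =O[𝓝[>] 0] M)
    (h : (fun h : ℝ => ∑ s ∈ stencil, C s h * jetPoly (robinJet L R β n) N (s.1 * h) (s.2 * h))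
      =O[𝓝[>] 0] fun h : ℝ => h ^ (n + 2) * M h) :
    (fun h : ℝ => moment (robinJet L R β n) n (fun s => C s h)
      + h * moment (robinJet L R β n) (n + 1) (fun s => C s h)) =O[𝓝[>] 0]
      fun h => h ^ 2 * M h := by
  obtain ⟨k, rfl⟩ := Nat.exists_eq_add_of_le hN
  have htail : (fun h : ℝ => ∑ d ∈ Finset.range (k + 1),
      h ^ (n + 2 + d) * moment (robinJet L R β n) (n + 2 + d) (fun s => C s h))
      =O[𝓝[>] 0] fun h => h ^ (n + 2) * M h :=
    IsBigO.fun_sum fun d _ => (isBigO_pow_of_le (by omega)).mul (moment_isBigO _ _ hC)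
  refine isBigO_of_pow_mul (n := n) ((h.sub htail).congr (fun h => ?_) fun h => by ring)
  rw [sum_mul_jetPoly (C := fun s => C s h), show n + 2 + k + 1 = n + 2 + (k + 1) by ring,
    Finset.sum_range_add, Finset.sum_range_succ, Finset.sum_range_succ, Finset.sum_eq_zero]
  · ring
  · intro d hd
    rw [moment_robinJet_of_lt (Finset.mem_range.1 hd), mul_zero]

lemma correctionWeight_eq_zero {ρ : ℕ → ℝ} (h : ∀ n ≤ 4, ρ n = 0) (s : ℤ × ℤ) :
    correctionWeight ρ s = 0 :=
  Finset.sum_eq_zero fun n _ => by rw [h n (Nat.le_of_lt_succ n.isLt), mul_zero]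

lemma tendsto_id_nhdsGT : Tendsto (fun h : ℝ => h) (𝓝[>] 0) (𝓝 0) :=
  tendsto_id.mono_left nhdsWithin_le_nhds

namespace SideRect

variable {D : SideRect} {a w : ℝ → ℝ → ℝ} {α : ℝ → ℝ} {c : ℤ × ℤ → ℕ → ℝ}

lemma tendsto_moment (J : ℕ → ℕ → ℝ) (n : ℕ) (c : ℤ × ℤ → ℕ → ℝ) :
    Tendsto (fun h => moment J n fun s => polyC c s h) (𝓝[>] 0)
      (𝓝 (moment J n fun s => c s 0)) :=
  tendsto_finsetSum _ fun s _ => (tendsto_polyC c s).mul_const _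

lemma SolvesSystem.expansion (hc : D.SolvesSystem a α c) {n : ℕ} (hn : n ≤ 4) :
    (fun h : ℝ => moment (D.boundaryJet a α n) n (fun s => polyC c s h)
      + h * moment (D.boundaryJet a α n) (n + 1) (fun s => polyC c s h))
      =O[𝓝[>] 0] fun h => h ^ 2 := by
  have hsys := (solvesSystem_iff.1 hc n (by omega)).trans
    (isBigO_pow_of_le (show n + 2 ≤ 7 by omega))
  simpa [boundaryJet] using moment_robinJet_expansion (N := 6) (M := fun _ => (1 : ℝ)) (by omega)
    (fun s _ => polyC_isBigO_one c s) (hsys.congr_right fun _ => (mul_one _).symm)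

lemma SolvesSystem.moment_eq_zero (hc : D.SolvesSystem a α c) {n : ℕ} (hn : n ≤ 4) :
    moment (D.boundaryJet a α n) n (fun s => c s 0) = 0 := by
  have hlim := (tendsto_moment (D.boundaryJet a α n) n c).add
    (tendsto_id_nhdsGT.mul (tendsto_moment (D.boundaryJet a α n) (n + 1) c))
  have hzero : Tendsto (fun h : ℝ => h ^ 2) (𝓝[>] 0) (𝓝 0) := by
    simpa using tendsto_id_nhdsGT.pow 2
  simpa using tendsto_nhds_unique hlim ((hc.expansion hn).trans_tendsto hzero)

lemma SolvesSystem.coeff_zero_eq (hc : D.SolvesSystem a α c) :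
    ∀ s ∈ stencil, c s 0 = c (1, -1) 0 * leadWeight s := fun s hs => by
  have hcorr : correctionWeight
      (fun n => moment (D.boundaryJet a α n) n fun s => c s 0) s = 0 :=
    correctionWeight_eq_zero (fun _ hn => hc.moment_eq_zero hn) s
  have hdec := eq_leadWeight_add_correctionWeight (L := D.pd fun x y => Real.log (a x y))
    (R := D.pd fun x y => (a x y)⁻¹) (β := D.bd α) (fun s => c s 0) s hs
  exact hdec.trans (add_eq_left.2 hcorr)

lemma SolvesSystem.tendsto_sum_div (hc : D.SolvesSystem a α c) :
    Tendsto (fun h : ℝ => h⁻¹ * ∑ s ∈ stencil, polyC c s h) (𝓝[>] 0)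
      (𝓝 (-(6 * c (1, -1) 0) * α D.y₀)) := by
  have hexp : Tendsto (fun h : ℝ => h⁻¹ * (moment (D.boundaryJet a α 0) 0 (fun s => polyC c s h)
      + h * moment (D.boundaryJet a α 0) (0 + 1) (fun s => polyC c s h))) (𝓝[>] 0) (𝓝 0) :=
    (inv_mul_isBigO (p := 1) (hc.expansion (n := 0) (by norm_num))).trans_tendsto
      (by simpa using tendsto_id_nhdsGT)
  have hlim := hexp.sub (tendsto_moment (D.boundaryJet a α 0) 1 c)
  have hκ : 0 - moment (D.boundaryJet a α 0) 1 (fun s => c s 0)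
      = -(6 * c (1, -1) 0) * α D.y₀ := by
    rw [boundaryJet, moment_robinJet_zero_add_one, hc.coeff_zero_eq (1, 0) (by decide),
      hc.coeff_zero_eq (1, 1) (by decide)]
    simp only [leadWeight, bd, iteratedDeriv_zero]
    norm_num
    ring
  rw [hκ] at hlim
  refine hlim.congr' ?_
  filter_upwards [self_mem_nhdsWithin] with h hh
  have : h ≠ 0 := ne_of_gt hh
  rw [boundaryJet, moment_robinJet_zero, sum_stencil]
  field_simp
  ring

lemma tendsto_slope_ray (hw : D.SmoothOn 1 w) {k : ℝ} (hk : 0 ≤ k) (l : ℝ) :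
    Tendsto (fun h : ℝ => h⁻¹ * (w (D.l₁ + k * h) (D.y₀ + l * h) - w D.l₁ D.y₀)) (𝓝[>] 0)
      (𝓝 (k * D.dx w D.l₁ D.y₀ + l * D.dy w D.l₁ D.y₀)) := by
  obtain ⟨b, hb, hr⟩ := exists_rayIn (D := D) hk l
  have hslope := hasDerivWithinAt_iff_tendsto_slope.1
    (hw.hasDerivWithinAt_ray hr (left_mem_Icc.2 hb.le))
  have hle : 𝓝[>] (0 : ℝ) ≤ 𝓝[Icc 0 b \ {0}] 0 := by
    refine le_inf nhdsWithin_le_nhds (le_principal_iff.2 ?_)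
    filter_upwards [Ioc_mem_nhdsGT hb] with h hh
    exact ⟨⟨hh.1.le, hh.2⟩, ne_of_gt hh.1⟩
  refine (by simpa using hslope.mono_left hle : Tendsto _ _ _).congr fun h => ?_
  simp [slope_def_field, div_eq_inv_mul]

lemma SolvesSystem.isConsistent (hc : D.SolvesSystem a α c) (h0 : ∃ s ∈ stencil, c s 0 ≠ 0) :
    (D.robinScheme a c).IsConsistent D α := by
  have hne : c (1, -1) 0 ≠ 0 := fun h => by
    obtain ⟨s, hs, hs'⟩ := h0
    exact hs' (by rw [hc.coeff_zero_eq s hs, h, zero_mul])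
  refine ⟨-(6 * c (1, -1) 0), by simpa using hne, fun w hw => ?_⟩
  have hlim := (hc.tendsto_sum_div.mul_const (w D.l₁ D.y₀)).add
    (tendsto_finsetSum stencil fun s hs =>
      (tendsto_polyC c s).mul (tendsto_slope_ray hw (zero_le_of_mem_stencil hs) s.2))
  have hκ : -(6 * c (1, -1) 0) * α D.y₀ * w D.l₁ D.y₀
      + ∑ s ∈ stencil, c s 0 * (s.1 * D.dx w D.l₁ D.y₀ + s.2 * D.dy w D.l₁ D.y₀)
      = -(6 * c (1, -1) 0) * D.robin α w D.y₀ := by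
    rw [Finset.sum_congr rfl fun s hs => by rw [hc.coeff_zero_eq s hs], sum_stencil]
    simp only [leadWeight, robin, dx]
    norm_num
    ring
  rw [hκ] at hlim
  refine hlim.congr fun h => ?_
  simp only [SixPointScheme.lhs, robinScheme, mul_assoc, Finset.sum_mul, Finset.mul_sum]
  rw [← Finset.sum_add_distrib]
  refine Finset.sum_congr rfl fun s _ => ?_
  ring

lemma robinScheme_nontrivial (h0 : ∃ s ∈ stencil, c s 0 ≠ 0) :
    (D.robinScheme a c).Nontrivial := by
  obtain ⟨s, hs, h⟩ := h0
  exact ⟨s, hs, fun ht => h (tendsto_nhds_unique (tendsto_polyC c s) ht)⟩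

end SideRect

/-! ### The order barrier -/

section Barrier

variable {L R : ℕ → ℕ → ℝ} {β : ℕ → ℝ} {C : ℤ × ℤ → ℝ → ℝ} {M : ℝ → ℝ}

lemma moment_add_smul (J : ℕ → ℕ → ℝ) (d : ℕ) {v w z : ℤ × ℤ → ℝ} {c : ℝ}
    (h : ∀ s ∈ stencil, v s = c * w s + z s) :
    moment J d v = c * moment J d w + moment J d z := by
  simp only [moment, Finset.mul_sum, ← Finset.sum_add_distrib]
  exact Finset.sum_congr rfl fun s hs => by rw [h s hs]; ring

lemma correctionWeight_isBigO {l : Filter ℝ} {ρ : ℝ → ℕ → ℝ}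
    (h : ∀ n ≤ 4, (fun t => ρ t n) =O[l] M) (s : ℤ × ℤ) :
    (fun t => correctionWeight (ρ t) s) =O[l] M :=
  IsBigO.fun_sum fun n _ => (h n (Nat.le_of_lt_succ n.isLt)).const_mul_left _

lemma leading_moment_isBigO (hC : ∀ s ∈ stencil, C s =O[𝓝[>] 0] M) {n : ℕ}
    (h : (fun h : ℝ => moment (robinJet L R β n) n (fun s => C s h)
      + h * moment (robinJet L R β n) (n + 1) (fun s => C s h))
      =O[𝓝[>] 0] fun h => h ^ 2 * M h) :
    (fun h => moment (robinJet L R β n) n fun s => C s h) =O[𝓝[>] 0] fun h => h * M h := by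
  have hsq : (fun h : ℝ => h ^ 2 * M h) =O[𝓝[>] 0] fun h => h * M h := by
    simpa using (isBigO_pow_of_le one_le_two).mul (isBigO_refl M (𝓝[>] 0))
  exact ((h.trans hsq).sub ((isBigO_refl (fun h : ℝ => h) (𝓝[>] 0)).mul
    (moment_isBigO (robinJet L R β n) (n + 1) hC))).congr_left fun h => add_sub_cancel_right _ _

lemma obstruction_isBigO
    (h₂ : (fun h : ℝ => moment (robinJet L R β 2) 2 (fun s => C s h)
      + h * moment (robinJet L R β 2) 3 (fun s => C s h))
      =O[𝓝[>] 0] fun h => h ^ 2 * M h)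
    (h₆ : (fun h : ℝ => moment (robinJet L R β 6) 6 (fun s => C s h)
      + h * moment (robinJet L R β 6) 7 (fun s => C s h))
      =O[𝓝[>] 0] fun h => h ^ 2 * M h) :
    (fun h => 360 * moment (robinJet L R β 6) 7 (fun s => C s h)
      - moment (robinJet L R β 2) 3 fun s => C s h) =O[𝓝[>] 0] fun h => h * M h := by
  refine isBigO_of_pow_mul (n := 1)
    (((h₆.const_mul_left 360).sub h₂).congr (fun t => ?_) fun t => by ring)
  linear_combination moment_robinJet_six (L := L) (R := R) (β := β) fun s => C s t

-- Up to `O(h M)` the weights are a multiple of `leadWeight`, on which the obstruction does not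
-- vanish.
lemma isBigO_mul_of_expansion (hne : 2 * β 0 + L 1 0 ≠ 0)
    (hC : ∀ s ∈ stencil, C s =O[𝓝[>] 0] M)
    (h : ∀ n ≤ 6, (fun h : ℝ => moment (robinJet L R β n) n (fun s => C s h)
      + h * moment (robinJet L R β n) (n + 1) (fun s => C s h))
      =O[𝓝[>] 0] fun h => h ^ 2 * M h) :
    ∀ s ∈ stencil, C s =O[𝓝[>] 0] fun h => h * M h := by
  set z : ℝ → ℤ × ℤ → ℝ := fun t =>
    correctionWeight fun n => moment (robinJet L R β n) n fun s => C s t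
  have hdec : ∀ t, ∀ s ∈ stencil, C s t = C (1, -1) t * leadWeight s + z t s := fun t =>
    eq_leadWeight_add_correctionWeight fun s => C s t
  have hzO : ∀ s, (fun t => z t s) =O[𝓝[>] 0] fun h => h * M h :=
    correctionWeight_isBigO fun n hn => leading_moment_isBigO hC (h n (by omega))
  have hmoment : ∀ J d, (fun t => moment J d (z t)) =O[𝓝[>] 0] fun h => h * M h := fun J d =>
    moment_isBigO J d (C := fun s t => z t s) fun s _ => hzO s
  have hlead : C (1, -1) =O[𝓝[>] 0] fun h => h * M h := by
    have hobstruction := ((obstruction_isBigO (h 2 (by norm_num)) (h 6 le_rfl)).sub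
      ((hmoment (robinJet L R β 6) 7).const_mul_left 360)).add (hmoment (robinJet L R β 2) 3)
    refine (hobstruction.const_mul_left (-(5 / 7) * (2 * β 0 + L 1 0))⁻¹).congr_left fun t => ?_
    rw [moment_add_smul _ 7 (hdec t), moment_add_smul _ 3 (hdec t),
      inv_mul_eq_iff_eq_mul₀ (mul_ne_zero (by norm_num) hne),
      ← moment_robinJet_six_add_one_leadWeight (R := R)]
    ring
  intro s hs
  refine ((hlead.const_mul_left (leadWeight s)).add (hzO s)).congr_left fun t => ?_
  rw [hdec t s hs]; ring

lemma one_isBigO_one_add_sum_abs (C : ℤ × ℤ → ℝ → ℝ) :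
    (fun _ => (1 : ℝ)) =O[𝓝[>] 0] fun h => 1 + ∑ s ∈ stencil, |C s h| :=
  isBigO_of_le _ fun h => by
    have := Finset.sum_nonneg fun s (_ : s ∈ stencil) => abs_nonneg (C s h)
    rw [Real.norm_of_nonneg zero_le_one, Real.norm_of_nonneg (by linarith)]
    linarith

lemma isBigO_one_add_sum_abs (C : ℤ × ℤ → ℝ → ℝ) {s : ℤ × ℤ} (hs : s ∈ stencil) :
    C s =O[𝓝[>] 0] fun h => 1 + ∑ s ∈ stencil, |C s h| :=
  isBigO_of_le _ fun h => by
    have := Finset.single_le_sum (f := fun s => |C s h|) (fun _ _ => abs_nonneg _) hs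
    rw [Real.norm_eq_abs, Real.norm_of_nonneg (by linarith [abs_nonneg (C s h)])]
    linarith

-- The sum `m` of the absolute values is `O(h + h m)`, and `h m` can be absorbed on the left.
lemma tendsto_zero_of_isBigO
    (h : ∀ s ∈ stencil, C s =O[𝓝[>] 0] fun h => h * (1 + ∑ s ∈ stencil, |C s h|)) :
    ∀ s ∈ stencil, Tendsto (C s) (𝓝[>] 0) (𝓝 0) := by
  set m : ℝ → ℝ := fun h => ∑ s ∈ stencil, |C s h|
  have hm₀ : ∀ h, 0 ≤ m h := fun h => Finset.sum_nonneg fun _ _ => abs_nonneg _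
  obtain ⟨K, hK, hb⟩ : ∃ K > 0, IsBigOWith K (𝓝[>] 0) m fun h => h * (1 + m h) :=
    IsBigO.exists_pos (IsBigO.fun_sum fun s hs => (h s hs).abs_left)
  have hsmall : m =O[𝓝[>] 0] fun h => h := by
    refine IsBigO.of_bound (2 * K) ?_
    filter_upwards [hb.bound, Ioo_mem_nhdsGT (show (0 : ℝ) < 1 / (2 * K) by positivity)]
      with t ht ⟨ht₀, ht₁⟩
    rw [Real.norm_of_nonneg (hm₀ t),
      Real.norm_of_nonneg (mul_nonneg ht₀.le (by linarith [hm₀ t]))] at ht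
    rw [Real.norm_of_nonneg (hm₀ t), Real.norm_of_nonneg ht₀.le]
    have : t * (2 * K) ≤ 1 := ((lt_div_iff₀ (by positivity)).1 ht₁).le
    nlinarith [mul_le_mul_of_nonneg_right this (hm₀ t)]
  intro s hs
  refine (IsBigO.trans (isBigO_of_le _ fun t => ?_) hsmall).trans_tendsto tendsto_id_nhdsGT
  rw [Real.norm_of_nonneg (hm₀ t)]
  exact Finset.single_le_sum (f := fun s => |C s t|) (fun _ _ => abs_nonneg _) hs

end Barrier

lemma SixPointScheme.HasTruncationOrder.mono {S : SixPointScheme} {D : SideRect}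
    {a : ℝ → ℝ → ℝ} {α : ℝ → ℝ} {r : ℕ∞} {p q : ℕ} (h : S.HasTruncationOrder D a α r p)
    (hq : q ≤ p) : S.HasTruncationOrder D a α r q :=
  fun u f g hu => (h u f g hu).trans (isBigO_pow_of_le hq)

namespace SideRect

variable {D : SideRect} {a u : ℝ → ℝ → ℝ} {α : ℝ → ℝ}

/-- The polynomial function with the jet `J` up to order `N` at the side point. -/
noncomputable def jetFun (D : SideRect) (J : ℕ → ℕ → ℝ) (N : ℕ) (x y : ℝ) : ℝ :=
  jetPoly J N (x - D.l₁) (y - D.y₀)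

lemma smoothOn_divMonomial (c : ℝ) (p : ℕ × ℕ) (r : ℕ∞) :
    D.SmoothOn r fun x y => c * divMonomial p (x - D.l₁) (y - D.y₀) := by
  unfold SmoothOn divMonomial
  exact ContDiff.contDiffOn (by fun_prop)

lemma smoothOn_jetFun (J : ℕ → ℕ → ℝ) (N : ℕ) (r : ℕ∞) : D.SmoothOn r (D.jetFun J N) :=
  SmoothOn.sum _ fun _ _ => smoothOn_divMonomial _ _ r

lemma pd_jetFun (J : ℕ → ℕ → ℝ) {N m n : ℕ} (h : m + n ≤ N) :
    D.pd (D.jetFun J N) m n = J m n := by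
  refine (pd_sum (Lam N) fun p _ => smoothOn_divMonomial (J p.1 p.2) p _).trans ?_
  simp only [pd_const_mul, pd_divMonomial]
  exact sum_Lam_mul_kron J h

lemma isExactSolution_top (ha : D.SmoothOn ⊤ a) (hα : D.SmoothSide ⊤ α) (hu : D.SmoothOn ⊤ u) :
    D.IsExactSolution a α ⊤ u (D.negDivGrad a u) (D.robin α u) where
  smooth_u := hu
  smooth_f := SmoothOn.negDivGrad ha hu
  smooth_g := ((SmoothOn.dx hu).slice_y D.l₁_mem).neg.add
    (ContDiffOn.mul hα (hu.slice_y D.l₁_mem))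
  pde _ hx _ hy := negDivGrad_eq (ha.of_le le_top) (hu.of_le le_top) hx hy
  bc _ _ := rfl

lemma pd_negDivGrad_jetFun_boundaryJet (ha : D.SmoothOn ⊤ a)
    (ha₀ : ∀ z ∈ D.OmegaBar, a z.1 z.2 ≠ 0) (n : ℕ) {N i j : ℕ} (h : i + j ≤ N) :
    D.pd (D.negDivGrad a (D.jetFun (D.boundaryJet a α n) (N + 2))) i j = 0 := by
  set u := D.jetFun (D.boundaryJet a α n) (N + 2)
  have hu : D.SmoothOn ⊤ u := smoothOn_jetFun _ _ _
  have hR : D.pd (fun x y => (a x y)⁻¹) 0 0 ≠ 0 := by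
    rw [pd_zero_zero]
    exact inv_ne_zero (ha₀ _ D.base_mem)
  refine (isJet_pd (N := N) ha₀ (ha.of_le le_top) (hu.of_le le_top)
    (SmoothOn.of_le (SmoothOn.negDivGrad ha hu) le_top) fun _ _ _ _ => rfl).source_eq_zero hR
    ((isJet_robinJet (N + 2)).congr fun k l hkl => (pd_jetFun _ hkl).symm) i j (by omega)

lemma bd_robin_jetFun_boundaryJet (hα : D.SmoothSide ⊤ α) (n : ℕ) {N i : ℕ} (h : i < N) :
    D.bd (D.robin α (D.jetFun (D.boundaryJet a α n) N)) i = 0 := by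
  rw [bd_robin (ContDiffOn.of_le hα (by exact_mod_cast le_top)) (smoothOn_jetFun _ _ _)
    fun _ _ => rfl, pd_jetFun _ (by omega), boundaryJet, robinJet_one, neg_add_eq_zero]
  have hterm : ∀ k ∈ Finset.range (i + 1),
      (i.choose k : ℝ) * D.bd α (i - k) * D.pd (D.jetFun (D.boundaryJet a α n) N) 0 k =
        if k = n then (i.choose k : ℝ) * D.bd α (i - k) else 0 := fun k hk => by
    rw [pd_jetFun _ (by grind), boundaryJet, robinJet_zero, mul_ite, mul_one, mul_zero]
  refine Eq.symm ((Finset.sum_congr rfl hterm).trans ?_)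
  rw [Finset.sum_ite_eq', ite_eq_left_iff, Finset.mem_range, not_lt]
  intro hn
  rw [Nat.choose_eq_zero_of_lt hn]
  simp

lemma _root_.SixPointScheme.HasTruncationOrder.sum_mul_jetPoly_isBigO (ha : D.SmoothOn ⊤ a)
    (ha₀ : ∀ z ∈ D.OmegaBar, a z.1 z.2 ≠ 0) (hα : D.SmoothSide ⊤ α) {S : SixPointScheme} {p : ℕ}
    (hS : S.HasTruncationOrder D a α ⊤ p) (n : ℕ) : (fun h : ℝ => ∑ s ∈ stencil, S.C s h *
      jetPoly (D.boundaryJet a α n) (S.Kf + S.Kg + 6 + 2) (s.1 * h) (s.2 * h))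
      =O[𝓝[>] 0] fun h : ℝ => h ^ (p + 1) := by
  set N := S.Kf + S.Kg + 6
  have htrunc := hS _ _ _ (isExactSolution_top ha hα
    (smoothOn_jetFun (D.boundaryJet a α n) (N + 2) ⊤))
  have hrhs : ∀ h, S.rhs D (D.negDivGrad a (D.jetFun (D.boundaryJet a α n) (N + 2)))
      (D.robin α (D.jetFun (D.boundaryJet a α n) (N + 2))) h = 0 := fun h => by
    rw [SixPointScheme.rhs, Finset.sum_eq_zero fun p hp => ?_, Finset.sum_eq_zero fun i hi => ?_,
      add_zero]
    · rw [bd_robin_jetFun_boundaryJet hα n (by grind), zero_mul]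
    · rw [pd_negDivGrad_jetFun_boundaryJet ha ha₀ n (by grind [mem_Lam]), zero_mul]
  simp only [hrhs, sub_zero, SixPointScheme.lhs, jetFun, add_sub_cancel_left] at htrunc
  refine ((isBigO_refl (fun h : ℝ => h) (𝓝[>] 0)).mul htrunc).congr' ?_ ?_
  · filter_upwards [self_mem_nhdsWithin] with h hh
    exact mul_inv_cancel_left₀ (ne_of_gt hh) _
  · filter_upwards with h
    rw [pow_succ']

lemma pd_log_one_zero (ha : D.SmoothOn 1 a) (ha₀ : ∀ z ∈ D.OmegaBar, a z.1 z.2 ≠ 0) :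
    D.pd (fun x y => Real.log (a x y)) 1 0 = D.pd a 1 0 / a D.l₁ D.y₀ := by
  simpa only [pd_eq, Function.iterate_zero, Function.iterate_one, id] using
    dx_log ha ha₀ _ D.l₁_mem _ D.y₀_mem

lemma not_nontrivial_of_hasTruncationOrder_seven (ha : D.SmoothOn ⊤ a)
    (ha₀ : ∀ z ∈ D.OmegaBar, a z.1 z.2 ≠ 0) (hα : D.SmoothSide ⊤ α)
    (hne : 2 * a D.l₁ D.y₀ * α D.y₀ + D.pd a 1 0 ≠ 0) {S : SixPointScheme}
    (hS : S.HasTruncationOrder D a α ⊤ 7) : ¬ S.Nontrivial := by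
  rintro ⟨s, hs, hnt⟩
  refine hnt (tendsto_zero_of_isBigO ?_ s hs)
  have hβ : 2 * D.bd α 0 + D.pd (fun x y => Real.log (a x y)) 1 0 ≠ 0 := fun h => hne <| by
    have : a D.l₁ D.y₀ ≠ 0 := ha₀ _ D.base_mem
    rw [pd_log_one_zero (ha.of_le le_top) ha₀, bd, iteratedDeriv_zero] at h
    field_simp at h
    linarith
  have hC := fun s hs => isBigO_one_add_sum_abs S.C (s := s) hs
  refine isBigO_mul_of_expansion hβ hC fun n hn => moment_robinJet_expansion (by omega) hC
    ((hS.sum_mul_jetPoly_isBigO ha ha₀ hα n).trans ?_)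
  simpa using (isBigO_pow_of_le (show n + 2 ≤ 7 + 1 by omega)).mul
    (one_isBigO_one_add_sum_abs S.C)

theorem exists_scheme_order_six (ha : D.SmoothOn ⊤ a) (ha₀ : ∀ z ∈ D.OmegaBar, a z.1 z.2 ≠ 0)
    (hα : D.SmoothSide ⊤ α) :
    ∃ S : SixPointScheme, S.Nontrivial ∧ S.HasTruncationOrder D a α ⊤ 6 := by
  obtain ⟨c, hc, h0⟩ := D.exists_solvesSystem a α
  exact ⟨D.robinScheme a c, robinScheme_nontrivial h0, fun u f g h =>
    hc.hasTruncationOrder ha₀ (ha.of_le le_top) (ContDiffOn.of_le hα (by exact_mod_cast le_top))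
      u f g (h.of_le le_top)⟩

theorem order_le_six (ha : D.SmoothOn ⊤ a) (ha₀ : ∀ z ∈ D.OmegaBar, a z.1 z.2 ≠ 0)
    (hα : D.SmoothSide ⊤ α) (hne : 2 * a D.l₁ D.y₀ * α D.y₀ + D.pd a 1 0 ≠ 0)
    {S : SixPointScheme} (hS : S.Nontrivial) {p : ℕ} (hp : S.HasTruncationOrder D a α ⊤ p) :
    p ≤ 6 := by
  by_contra! h
  exact not_nontrivial_of_hasTruncationOrder_seven ha ha₀ hα hne (hp.mono h) hS

end SideRect

theorem theorem2p2_general (D : SideRect) :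
    (∀ (a : ℝ → ℝ → ℝ) (α : ℝ → ℝ), D.SmoothOn 5 a → (∀ z ∈ D.OmegaBar, a z.1 z.2 ≠ 0) →
      D.SmoothSide 5 α →
        (∀ c : ℤ × ℤ → ℕ → ℝ, D.SolvesSystem a α c →
          (D.robinScheme a c).HasTruncationOrder D a α 5 6 ∧
          ((∃ s ∈ stencil, c s 0 ≠ 0) → (D.robinScheme a c).IsConsistent D α)) ∧
        (∃ c : ℤ × ℤ → ℕ → ℝ, D.SolvesSystem a α c ∧ ∃ s ∈ stencil, c s 0 ≠ 0)) ∧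
    IsGreatest {p : ℕ | ∀ (a : ℝ → ℝ → ℝ) (α : ℝ → ℝ), D.SmoothOn ⊤ a →
      (∀ z ∈ D.OmegaBar, 0 < a z.1 z.2) → D.SmoothSide ⊤ α →
        ∃ S : SixPointScheme, S.Nontrivial ∧ S.HasTruncationOrder D a α ⊤ p} 6 ∧
    (∀ (a : ℝ → ℝ → ℝ) (α : ℝ → ℝ), D.SmoothOn ⊤ a → (∀ z ∈ D.OmegaBar, a z.1 z.2 ≠ 0) →
      D.SmoothSide ⊤ α → 2 * a D.l₁ D.y₀ * α D.y₀ + D.pd a 1 0 ≠ 0 →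
        IsGreatest {p : ℕ | ∃ S : SixPointScheme,
          S.Nontrivial ∧ S.HasTruncationOrder D a α ⊤ p} 6) := by
  refine ⟨fun a α ha ha₀ hα => ⟨fun c hc => ⟨hc.hasTruncationOrder ha₀ ha hα, hc.isConsistent⟩,
    D.exists_solvesSystem a α⟩, ⟨fun a α ha ha₀ hα => ?_, fun p hp => ?_⟩,
    fun a α ha ha₀ hα hne => ⟨SideRect.exists_scheme_order_six ha ha₀ hα, ?_⟩⟩
  · exact SideRect.exists_scheme_order_six ha (fun z hz => (ha₀ z hz).ne') hα
  · have hone : D.SmoothOn ⊤ fun _ _ => 1 := contDiffOn_const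
    have hone' : D.SmoothSide ⊤ fun _ => 1 := contDiffOn_const
    obtain ⟨S, hS, hSp⟩ := hp _ _ hone (fun _ _ => one_pos) hone'
    exact SideRect.order_le_six hone (fun _ _ => one_ne_zero) hone' (by simp [SideRect.pd]) hS hSp
  · rintro p ⟨S, hS, hSp⟩
    exact SideRect.order_le_six ha ha₀ hα hne hS hSp

theorem theorem2p2 (D : SideRect) :
    (∀ (a : ℝ → ℝ → ℝ) (α : ℝ → ℝ), D.SmoothOn 6 a → (∀ z ∈ D.OmegaBar, 0 < a z.1 z.2) →
      D.SmoothSide 5 α →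
        (∀ c : ℤ × ℤ → ℕ → ℝ, D.SolvesSystem a α c →
          (D.robinScheme a c).HasTruncationOrder D a α 5 6 ∧
          ((∃ s ∈ stencil, c s 0 ≠ 0) → (D.robinScheme a c).IsConsistent D α)) ∧
        (∃ c : ℤ × ℤ → ℕ → ℝ, D.SolvesSystem a α c ∧ ∃ s ∈ stencil, c s 0 ≠ 0)) ∧
    IsGreatest {p : ℕ | ∀ (a : ℝ → ℝ → ℝ) (α : ℝ → ℝ), D.SmoothOn ⊤ a →
      (∀ z ∈ D.OmegaBar, 0 < a z.1 z.2) → D.SmoothSide ⊤ α →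
        ∃ S : SixPointScheme, S.Nontrivial ∧ S.HasTruncationOrder D a α ⊤ p} 6 ∧
    (∀ (a : ℝ → ℝ → ℝ) (α : ℝ → ℝ), D.SmoothOn ⊤ a → (∀ z ∈ D.OmegaBar, 0 < a z.1 z.2) →
      D.SmoothSide ⊤ α → 2 * a D.l₁ D.y₀ * α D.y₀ + D.pd a 1 0 ≠ 0 →
        IsGreatest {p : ℕ | ∃ S : SixPointScheme,
          S.Nontrivial ∧ S.HasTruncationOrder D a α ⊤ p} 6) := by
  obtain ⟨hsix, hgreatest, hsharp⟩ := theorem2p2_general D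
  exact ⟨fun a α ha hpos hα => hsix a α (ha.of_le (by norm_num)) (fun z hz => (hpos z hz).ne') hα,
    hgreatest, fun a α ha hpos hα => hsharp a α ha (fun z hz => (hpos z hz).ne') hα⟩
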